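/- **Setting.** Let $d\ge 1$, $n=2^d$ (so $\log_2 n=d$), and $\mathcal X=\{\pm1\}^n$. A tree-structured Boolean circuit $C$ of depth $d$ is a full binary tree with leaves $x_1,\dots,x_n$ and a gate $\{\pm1\}^2\to\{\pm1\}$ at each inner node; $h_C:\mathcal X\to\{\pm1\}$ is the function it computes. For $I\subseteq[n]$, the parity circuit of $I$ has bottom gates $(z_1,z_2)\mapsto$ the product of those of the two input bits whose index lies in $I$ (and $1$ if there are none), and all other gates are $z_1z_2$. A *neural gate* of width $k$ is $g_{w,v}(x)=\phi\big(\sum_{l=1}^k v_l\,\sigma(\langle w_l,x\rangle)\big)$ on $\mathbb R^2$, where $\sigma(t)=\max(t,0)$ and $\phi(t)=\max(\min(t,1),-1)$. For $i=1,\dots,d$ a block $B_{W,V}:\mathbb R^{2^i}\to\mathbb R^{2^{i-1}}$ applies one neural gate to each consecutive pair of coordinates. $P$ denotes the average of the coordinates, and for a sample $S$ of $m$ labelled examples $L_S(f)=\frac1m\sum_{(x,y)\in S}\big(\max(1-y f(x),0)+\lambda|1-f(x)|\big)$. *Layerwise gradient descent* (Algorithm 1) on $S$ with learning rate $\eta$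 and $T$ iterations per layer starts with $\mathcal N_d=\mathrm{id}$; for $i=d,\dots,1$ it initializes $W_0^{(i)},V_0^{(i)}$, performs $T$ steps $W\leftarrow W-\eta\,\partial_W L_S\big(P(B_{W,V_0^{(i)}}\circ\mathcal N_i)\big)$ from $W_0^{(i)}$ (chain rule, with the derivative of each of the scalar functions $\sigma$, $\phi$, hinge loss, regularizer taken to be $0$ at its kinks), and sets $\mathcal N_{i-1}=B_{W_T^{(i)},V_0^{(i)}}\circ\mathcal N_i$; it returns $\mathcal N_0$. The hidden neurons are initialized independently, each with $v$ uniform in $\{\pm1\}$ and, independently of $v$, with $w\in\mathbb R^2$ drawn from a law $\mu$ such that almost surely $\|w\|_\infty\le\frac1{4\sqrt2\,k}$, and $\mu(\langle w,b\rangle>0)=\frac12$ for each $b\in\{\pm1\}^2$ (for example, uniform on the square). **Statement.** Fix $\xi\in(0,\frac14)$, and put $\epsilon=\xi^2$, $\Delta=(2\xi)^{d}=(2\xi)^{\log_2 n}$. 1. For every $d\ge1$ and $I\subseteq[n]$, the parity circuit $C$ of $I$ satisfies $h_C(x)=\prod_{j\in I}x_j$ for all $x\in\mathcal X$. 2. Let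 $d\ge1$, $\delta\in(0,\frac12)$, and let the width $k$, the sample size $m$, the number of iterations $T$ and the rate $\eta>0$ be *admissible*, that is $$k\ge\frac{\log(2nd/\delta)}{\log(4/3)},\quad \eta\le\frac1{16\sqrt2\,k},\quad m>\frac{2^{11}}{\epsilon^2\Delta^2}\log\frac{8nd}{\delta},\quad T>\frac{6n}{\sqrt2\,\eta\,\epsilon\,\Delta}.$$ Let $\mathcal D_{\mathcal X}$ be a product distribution on $\mathcal X$ with $p_j=\Pr(x_j=1)\in(\xi,\frac12-\xi)\cup(\frac12+\xi,1-\xi)$ for every $j$, let $I\subseteq[n]$ with $|I|=d=\log_2 n$, and let $C$ be the parity circuit of $I$. Let $s\in\{\pm1\}$ be such that the law $\mathcal D$ of $(x,\,s\prod_{j\in I}x_j)$, $x\sim\mathcal D_{\mathcal X}$, has $\mathbb E_{\mathcal D}[y]\ge0$ (so $s=1$, or the labels are swapped), and let $\lambda=\mathbb E_{\mathcal D}[y]+\frac\Delta4$. Then, with probability at least $1-\delta$ over the i.i.d. sample $S\sim\mathcal D^m$ and the independent initialization, Algorithm 1 returns $\mathcal N_0$ with $\mathcal N_0(x)=s\,h_C(x)$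 for every $x\in\mathcal X$. 3. There are constants $C_0$ and $a\in\mathbb N$ depending only on $\xi$ such that for all $d\ge1$ and $\delta\in(0,\frac12)$ there are admissible $k,m,T,\eta$ with $m\le C_0\,(n\log\frac1\delta)^a$ for which Algorithm 1, implemented by an explicit program over the reals that returns the weights of $\mathcal N_0$, uses at most $C_0\,(n\log\frac1\delta)^a$ unit-cost steps (arithmetic operations, comparisons, reads and writes of real numbers, loop iterations) on every sample and every initialization, and for every $\lambda\in\mathbb R$. -/

import Mathlib

open MeasureTheory


noncomputable section

namespace LayerwiseGD

/-! ### Tree-structured Boolean circuits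

Bits are elements of `ℤˣ = {1, -1}`.  Layers are indexed by their number of outputs: layer `i`
maps `2 ^ (i + 1)` values to `2 ^ i` values, the layer next to the inputs is `i = d - 1` and the
layer of the output node is `i = 0`. -/

/-- A bit `±1` as a real number. -/
def bit (b : ℤˣ) : ℝ := ((b : ℤ) : ℝ)

/-- The index of the `q`-th of the two inputs of the `j`-th node of layer `i`. -/
def child {i : ℕ} (j : Fin (2 ^ i)) (q : Fin 2) : Fin (2 ^ (i + 1)) :=
  ⟨2 * j.val + q.val, by
    have hj := j.isLt
    have hq := q.isLt
    rw [pow_succ]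
    omega⟩

/-- A circuit on a full binary tree of depth `d`: an arbitrary Boolean gate at each inner node. -/
def TreeCircuit (d : ℕ) : Type := (i : Fin d) → Fin (2 ^ (i : ℕ)) → ℤˣ → ℤˣ → ℤˣ

/-- Apply the layers `i - 1, …, 0` of a circuit to `2 ^ i` bits. -/
def TreeCircuit.evalFrom {d : ℕ} (C : TreeCircuit d) :
    (i : ℕ) → i ≤ d → (Fin (2 ^ i) → ℤˣ) → ℤˣ
  | 0, _, x => x 0
  | i + 1, h, x =>
      C.evalFrom i (Nat.le_of_succ_le h)
        (fun j => C ⟨i, h⟩ j (x (child j 0)) (x (child j 1)))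

/-- The function `h_C` computed by the circuit on its `2 ^ d` input bits. -/
def TreeCircuit.eval {d : ℕ} (C : TreeCircuit d) (x : Fin (2 ^ d) → ℤˣ) : ℤˣ :=
  C.evalFrom d le_rfl x

/-- The parity of the bits in `I`. -/
def parity {n : ℕ} (I : Finset (Fin n)) (x : Fin n → ℤˣ) : ℤˣ := ∏ j ∈ I, x j

/-- The circuit of the parity on `I`: a gate of the bottom layer multiplies those of its two input
bits that belong to `I` (and is constant `1` if there are none), all other gates are products. -/
def parityCircuit {d : ℕ} (I : Finset (Fin (2 ^ d))) : TreeCircuit d :=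
  fun i j z₁ z₂ =>
    if (i : ℕ) + 1 = d then
      (if ∃ a ∈ I, a.val = 2 * j.val then z₁ else 1) *
        (if ∃ a ∈ I, a.val = 2 * j.val + 1 then z₂ else 1)
    else z₁ * z₂

/-! ### Distributions -/

/-- The law of a random bit that is `1` with probability `p`. -/
def bitLaw (p : ℝ) : Measure ℤˣ :=
  ENNReal.ofReal p • Measure.dirac 1 + ENNReal.ofReal (1 - p) • Measure.dirac (-1)

/-- The product distribution on `{±1}ⁿ` with `P(x_j = 1) = p_j`. -/
def productLaw {n : ℕ} (p : Fin n → ℝ) : Measure (Fin n → ℤˣ) :=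
  Measure.pi fun j => bitLaw (p j)

/-- The law of `(x, s * f x)`, where `x` has the product law and `f` is the parity on `I`.
For `s = 1` these are the examples of the parity problem, for `s = -1` the labels are swapped. -/
def exampleLaw {n : ℕ} (p : Fin n → ℝ) (I : Finset (Fin n)) (s : ℤˣ) :
    Measure ((Fin n → ℤˣ) × ℤˣ) :=
  (productLaw p).map fun x => (x, s * parity I x)

/-- The mean label `E_D[y]`. -/
def meanLabel {n : ℕ} (D : Measure ((Fin n → ℤˣ) × ℤˣ)) : ℝ := ∫ e, bit e.2 ∂D

/-! ### Neural gates, blocks, and the loss -/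

def relu (x : ℝ) : ℝ := max x 0

def hardTanh (x : ℝ) : ℝ := max (min x 1) (-1)

/-- `⟨w, x⟩` in the plane. -/
def dot (w x : Fin 2 → ℝ) : ℝ := ∑ q, w q * x q

/-- The value of the output neuron of a neural gate of width `k` before the hard-tanh. -/
def preAct {k : ℕ} (w : Fin k → Fin 2 → ℝ) (v : Fin k → ℝ) (x : Fin 2 → ℝ) : ℝ :=
  ∑ l, v l * relu (dot (w l) x)

def neuralGate {k : ℕ} (w : Fin k → Fin 2 → ℝ) (v : Fin k → ℝ) (x : Fin 2 → ℝ) : ℝ :=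
  hardTanh (preAct w v x)

/-- The two inputs of the `j`-th gate of layer `i`. -/
def inputPair {i : ℕ} (x : Fin (2 ^ (i + 1)) → ℝ) (j : Fin (2 ^ i)) : Fin 2 → ℝ :=
  fun q => x (child j q)

/-- First-layer weights of all gates of layer `i`. -/
abbrev LayerW (i k : ℕ) : Type := Fin (2 ^ i) → Fin k → Fin 2 → ℝ

/-- Second-layer weights of all gates of layer `i`. -/
abbrev LayerV (i k : ℕ) : Type := Fin (2 ^ i) → Fin k → ℝ

/-- A block: one neural gate for each gate of layer `i`. -/
def block {i k : ℕ} (W : LayerW i k) (V : LayerV i k) (x : Fin (2 ^ (i + 1)) → ℝ) :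
    Fin (2 ^ i) → ℝ :=
  fun j => neuralGate (W j) (V j) (inputPair x j)

/-- Average pooling. -/
def avgPool {n : ℕ} (x : Fin n → ℝ) : ℝ := (1 / (n : ℝ)) * ∑ j, x j

/-- The hinge loss of the prediction `z` for the label `y`. -/
def hinge (y z : ℝ) : ℝ := max (1 - y * z) 0

/-- The regularization term `R_λ`. -/
def reg (lam z : ℝ) : ℝ := lam * |1 - z|

/-- The input of an example as a real vector. -/
def realInput {n : ℕ} (x : Fin n → ℤˣ) : Fin n → ℝ := fun j => bit (x j)

/-- The empirical loss `L_S(f)` of a predictor on a sample of size `m`. -/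
def empLoss {n m : ℕ} (lam : ℝ) (S : Fin m → (Fin n → ℤˣ) × ℤˣ) (f : (Fin n → ℝ) → ℝ) : ℝ :=
  (1 / (m : ℝ)) * ∑ e, (hinge (bit (S e).2) (f (realInput (S e).1))
    + reg lam (f (realInput (S e).1)))

/-- The (sub)gradient of `W ↦ L_S(P(B_{W,V} ∘ N))`, by the chain rule (back-propagation).  Mathlib's
`deriv` is `0` at a kink of the scalar functions `relu`, `hardTanh`, `hinge y`, `reg lam`: this is
the convention that the sub-gradient at a kink is zero. -/
def lossGrad {n m i k : ℕ} (lam : ℝ) (S : Fin m → (Fin n → ℤˣ) × ℤˣ)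
    (N : (Fin n → ℝ) → (Fin (2 ^ (i + 1)) → ℝ)) (V : LayerV i k) (W : LayerW i k) : LayerW i k :=
  fun j l q =>
    (1 / (m : ℝ)) * ∑ e,
      (let x := N (realInput (S e).1)
       let yhat := avgPool (block W V x)
       (deriv (hinge (bit (S e).2)) yhat + deriv (reg lam) yhat) *
        ((1 / ((2 ^ i : ℕ) : ℝ)) *
          (deriv hardTanh (preAct (W j) (V j) (inputPair x j)) *
            (V j l * (deriv relu (dot (W j l) (inputPair x j)) * inputPair x j q)))))

/-- Away from the kinks, `lossGrad` is the gradient of the empirical loss: the derivative along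
every line of weights is the inner product with the direction. -/
theorem hasDerivAt_empLoss {n m i k : ℕ} (lam : ℝ) (S : Fin m → (Fin n → ℤˣ) × ℤˣ)
    (N : (Fin n → ℝ) → (Fin (2 ^ (i + 1)) → ℝ)) (V : LayerV i k) (W U : LayerW i k)
    (h₁ : ∀ e, DifferentiableAt ℝ (hinge (bit (S e).2)) (avgPool (block W V (N (realInput (S e).1)))))
    (h₂ : ∀ e, DifferentiableAt ℝ (reg lam) (avgPool (block W V (N (realInput (S e).1)))))
    (h₃ : ∀ e j, DifferentiableAt ℝ hardTanh
      (preAct (W j) (V j) (inputPair (N (realInput (S e).1)) j)))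
    (h₄ : ∀ e j l, DifferentiableAt ℝ relu (dot (W j l) (inputPair (N (realInput (S e).1)) j))) :
    HasDerivAt (fun t : ℝ => empLoss lam S fun x => avgPool (block (W + t • U) V (N x)))
      (∑ j, ∑ l, ∑ q, lossGrad lam S N V W j l q * U j l q) 0 := by
  have hW : W + (0 : ℝ) • U = W := by simp
  have hdot : ∀ e j l, HasDerivAt
      (fun t : ℝ => dot ((W + t • U) j l) (inputPair (N (realInput (S e).1)) j))
      (∑ q, U j l q * inputPair (N (realInput (S e).1)) j q) 0 := by
    intro e j l
    unfold dot
    refine HasDerivAt.fun_sum fun q _ => ?_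
    have h := (((hasDerivAt_id (0 : ℝ)).mul_const (U j l q)).const_add (W j l q)).mul_const
      (inputPair (N (realInput (S e).1)) j q)
    simpa using h
  have hpre : ∀ e j, HasDerivAt
      (fun t : ℝ => preAct ((W + t • U) j) (V j) (inputPair (N (realInput (S e).1)) j))
      (∑ l, V j l * (deriv relu (dot (W j l) (inputPair (N (realInput (S e).1)) j)) *
        ∑ q, U j l q * inputPair (N (realInput (S e).1)) j q)) 0 := by
    intro e j
    unfold preAct
    refine HasDerivAt.fun_sum fun l _ => HasDerivAt.const_mul _ ?_
    refine HasDerivAt.comp (h₂ := relu) (0 : ℝ) ?_ (hdot e j l)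
    rw [hW]
    exact (h₄ e j l).hasDerivAt
  have hblock : ∀ e, HasDerivAt
      (fun t : ℝ => avgPool (block (W + t • U) V (N (realInput (S e).1))))
      ((1 / ((2 ^ i : ℕ) : ℝ)) * ∑ j, deriv hardTanh
        (preAct (W j) (V j) (inputPair (N (realInput (S e).1)) j)) *
        ∑ l, V j l * (deriv relu (dot (W j l) (inputPair (N (realInput (S e).1)) j)) *
          ∑ q, U j l q * inputPair (N (realInput (S e).1)) j q)) 0 := by
    intro e
    unfold avgPool block neuralGate
    refine HasDerivAt.const_mul _ (HasDerivAt.fun_sum fun j _ => ?_)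
    refine HasDerivAt.comp (h₂ := hardTanh) (0 : ℝ) ?_ (hpre e j)
    rw [hW]
    exact (h₃ e j).hasDerivAt
  have hmain : HasDerivAt (fun t : ℝ => empLoss lam S fun x => avgPool (block (W + t • U) V (N x)))
      ((1 / (m : ℝ)) * ∑ e, (deriv (hinge (bit (S e).2))
          (avgPool (block W V (N (realInput (S e).1)))) +
        deriv (reg lam) (avgPool (block W V (N (realInput (S e).1))))) *
        ((1 / ((2 ^ i : ℕ) : ℝ)) * ∑ j, deriv hardTanh
          (preAct (W j) (V j) (inputPair (N (realInput (S e).1)) j)) *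
          ∑ l, V j l * (deriv relu (dot (W j l) (inputPair (N (realInput (S e).1)) j)) *
            ∑ q, U j l q * inputPair (N (realInput (S e).1)) j q))) 0 := by
    unfold empLoss
    refine HasDerivAt.const_mul _ (HasDerivAt.fun_sum fun e _ => ?_)
    rw [add_mul]
    refine HasDerivAt.add ?_ ?_
    · refine HasDerivAt.comp (h₂ := hinge (bit (S e).2)) (0 : ℝ) ?_ (hblock e)
      rw [hW]
      exact (h₁ e).hasDerivAt
    · refine HasDerivAt.comp (h₂ := reg lam) (0 : ℝ) ?_ (hblock e)
      rw [hW]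
      exact (h₂ e).hasDerivAt
  convert hmain using 1
  simp only [lossGrad, Finset.mul_sum, Finset.sum_mul]
  conv_rhs => rw [Finset.sum_comm]
  refine Finset.sum_congr rfl fun j _ => ?_
  conv_rhs => rw [Finset.sum_comm]
  refine Finset.sum_congr rfl fun l _ => ?_
  conv_rhs => rw [Finset.sum_comm]
  refine Finset.sum_congr rfl fun q _ => Finset.sum_congr rfl fun e _ => ?_
  ring

/-! ### Layerwise gradient descent -/

/-- The initial weights `(w, v)` of all hidden neurons of the network of depth `d`. -/
abbrev Init (d k : ℕ) : Type :=
  (i : Fin d) → Fin (2 ^ (i : ℕ)) → Fin k → (Fin 2 → ℝ) × ℤˣ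

def Init.W {d k : ℕ} (ω : Init d k) (i : Fin d) : LayerW i k := fun j l => (ω i j l).1

def Init.V {d k : ℕ} (ω : Init d k) (i : Fin d) : LayerV i k := fun j l => bit (ω i j l).2

/-- The weights after `T` gradient steps on one layer. -/
def trainLayer {n m i k : ℕ} (lam η : ℝ) (T : ℕ) (S : Fin m → (Fin n → ℤˣ) × ℤˣ)
    (N : (Fin n → ℝ) → (Fin (2 ^ (i + 1)) → ℝ)) (V : LayerV i k) (W₀ : LayerW i k) : LayerW i k :=
  (fun W : LayerW i k => W - η • lossGrad lam S N V W)^[T] W₀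

/-- The loop of the algorithm: given the network `N` for the layers below, train the layers
`i - 1, …, 0` one after the other, and return the complete network. -/
def trainFrom {d m k : ℕ} (lam η : ℝ) (T : ℕ) (S : Fin m → (Fin (2 ^ d) → ℤˣ) × ℤˣ)
    (ω : Init d k) :
    (i : ℕ) → i ≤ d → ((Fin (2 ^ d) → ℝ) → (Fin (2 ^ i) → ℝ)) → (Fin (2 ^ d) → ℝ) → ℝ
  | 0, _, N => fun x => N x 0
  | i + 1, h, N =>
      trainFrom lam η T S ω i (Nat.le_of_succ_le h)
        (block (trainLayer lam η T S N (ω.V ⟨i, h⟩) (ω.W ⟨i, h⟩)) (ω.V ⟨i, h⟩) ∘ N)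

/-- Layerwise gradient descent on the sample `S`, with learning rate `η`, `T` iterations for each
layer and initial weights `ω`; the value is the returned network. -/
def layerwiseGD {d m k : ℕ} (lam η : ℝ) (T : ℕ) (S : Fin m → (Fin (2 ^ d) → ℤˣ) × ℤˣ)
    (ω : Init d k) : (Fin (2 ^ d) → ℝ) → ℝ :=
  trainFrom lam η T S ω d le_rfl id

/-- The law of the initial weights: independent neurons, `w` drawn from `μ`, and `v` a uniform
random sign that is independent of `w`. -/
def initLaw (d k : ℕ) (μ : Measure (Fin 2 → ℝ)) : Measure (Init d k) :=
  Measure.pi fun _ => Measure.pi fun _ => Measure.pi fun _ => μ.prod (bitLaw (1 / 2))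

/-- The laws allowed for the initial first-layer weights of a neuron in a network of width `k`:
bounded by `1 / (4 √2 k)` in maximum norm, and positively correlated with each of the four patterns
with probability `1 / 2`. -/
def IsInitLaw (k : ℕ) (μ : Measure (Fin 2 → ℝ)) : Prop :=
  IsProbabilityMeasure μ ∧
  (∀ᵐ w ∂μ, ∀ q, |w q| ≤ 1 / (4 * √2 * k)) ∧
  ∀ b : Fin 2 → ℤˣ, μ {w | 0 < dot w (realInput b)} = 1 / 2

/-- The conditions on the width `k`, the sample size `m`, the number `T` of iterations for each
layer, and the learning rate `η`, for `n = 2 ^ d`, `Δ = (2 ξ) ^ d` and `ε = ξ ^ 2`. -/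
structure Admissible (ξ δ : ℝ) (d k m T : ℕ) (η : ℝ) : Prop where
  width : Real.log (2 * 2 ^ d * d / δ) / Real.log (4 / 3) ≤ k
  rate_pos : 0 < η
  rate_le : η ≤ 1 / (16 * √2 * k)
  sample : 2 ^ 11 / ((ξ ^ 2) ^ 2 * ((2 * ξ) ^ d) ^ 2) * Real.log (8 * 2 ^ d * d / δ) < m
  iters : 6 * 2 ^ d / (√2 * η * ξ ^ 2 * (2 * ξ) ^ d) < T

/-! ### A step-counting implementation

Unit-cost model: one step for an arithmetic operation, comparison or memory access on real numbers,
for each term of a sum, for each array entry that is written, and for each iteration of a loop. -/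

/-- A value together with the number of steps spent to compute it. -/
structure Timed (α : Type) : Type where
  val : α
  steps : ℕ

namespace Timed

instance : Monad Timed where
  pure a := ⟨a, 0⟩
  bind a f := ⟨(f a.val).val, a.steps + (f a.val).steps⟩

/-- One elementary operation. -/
def tick {α : Type} (a : α) : Timed α := ⟨a, 1⟩

/-- Compute the entries of an array of length `n` and store them. -/
def tabulate {α : Type} {n : ℕ} (f : Fin n → Timed α) : Timed (Fin n → α) :=
  ⟨fun j => (f j).val, n + ∑ j, (f j).steps⟩

/-- Compute `n` terms and add them up. -/
def sum {n : ℕ} (f : Fin n → Timed ℝ) : Timed ℝ :=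
  ⟨∑ j, (f j).val, n + ∑ j, (f j).steps⟩

/-- A loop of `T` iterations. -/
def loop {α : Type} (f : α → Timed α) : ℕ → α → Timed α
  | 0, a => pure a
  | T + 1, a => do
      tick ()
      let b ← f a
      loop f T b

def dot (w x : Fin 2 → ℝ) : Timed ℝ := sum fun q => tick (w q * x q)

def relu (z : ℝ) : Timed ℝ := tick (max z 0)

def hardTanh (z : ℝ) : Timed ℝ := do
  let a ← tick (min z 1)
  tick (max a (-1))

def preAct {k : ℕ} (w : Fin k → Fin 2 → ℝ) (v : Fin k → ℝ) (x : Fin 2 → ℝ) : Timed ℝ :=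
  sum fun l => do
    let a ← dot (w l) x
    let b ← relu a
    tick (v l * b)

def inputPair {i : ℕ} (x : Fin (2 ^ (i + 1)) → ℝ) (j : Fin (2 ^ i)) : Timed (Fin 2 → ℝ) :=
  tabulate fun q => tick (x (child j q))

def block {i k : ℕ} (W : LayerW i k) (V : LayerV i k) (x : Fin (2 ^ (i + 1)) → ℝ) :
    Timed (Fin (2 ^ i) → ℝ) :=
  tabulate fun j => do
    let u ← inputPair x j
    let z ← preAct (W j) (V j) u
    hardTanh z

/-- The number `n` as a real number, by counting. -/
def count (n : ℕ) : Timed ℝ := sum fun _ : Fin n => tick 1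

/-- The derivative of the regularized loss in the prediction `z`, for the label `y`. -/
def lossDeriv (lam y z : ℝ) : Timed ℝ := do
  let a ← tick (y * z)
  let b ← tick (-y)
  let h ← tick (if a < 1 then b else 0)
  let c ← tick (-lam)
  let r ← tick (if 1 < z then lam else 0)
  let r ← tick (if z < 1 then c else r)
  tick (h + r)

def reluDeriv (z : ℝ) : Timed ℝ := tick (if 0 < z then 1 else 0)

def hardTanhDeriv (z : ℝ) : Timed ℝ := do
  let a ← tick (if -1 < z then (1 : ℝ) else 0)
  tick (if z < 1 then a else 0)

/-- The gradient of the loss, from the outputs `F` of the layers below and the labels `Y`. -/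
def lossGrad {m i k : ℕ} (lam : ℝ) (F : Fin m → Fin (2 ^ (i + 1)) → ℝ) (Y : Fin m → ℝ)
    (V : LayerV i k) (W : LayerW i k) : Timed (LayerW i k) := do
  let size ← count m
  let width ← count (2 ^ i)
  let G ← tabulate fun e => do
    let b ← block W V (F e)
    let total ← sum fun j => tick (b j)
    let yhat ← tick (total / width)
    let c ← lossDeriv lam (Y e) yhat
    tick (c / width)
  tabulate fun j => tabulate fun l => tabulate fun q => do
    let total ← sum fun e => do
      let u ← inputPair (F e) j
      let z ← preAct (W j) (V j) u
      let a ← hardTanhDeriv z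
      let t ← dot (W j l) u
      let b ← reluDeriv t
      let r ← tick (b * u q)
      let r ← tick (V j l * r)
      let r ← tick (a * r)
      tick (G e * r)
    tick (total / size)

def trainLayer {m i k : ℕ} (lam η : ℝ) (T : ℕ) (F : Fin m → Fin (2 ^ (i + 1)) → ℝ)
    (Y : Fin m → ℝ) (V : LayerV i k) (W₀ : LayerW i k) : Timed (LayerW i k) :=
  loop (fun W => do
    let g ← lossGrad lam F Y V W
    tabulate fun j => tabulate fun l => tabulate fun q => do
      let r ← tick (η * g j l q)
      tick (W j l q - r)) T W₀

end Timed

/-- The weights of a network with the layers `i - 1, …, 0`. -/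
def NetWeights (k : ℕ) : ℕ → Type
  | 0 => Unit
  | i + 1 => (LayerW i k × LayerV i k) × NetWeights k i

/-- The function computed by a network with the layers `i - 1, …, 0`. -/
def NetWeights.eval {k : ℕ} : (i : ℕ) → NetWeights k i → (Fin (2 ^ i) → ℝ) → ℝ
  | 0, _, x => x 0
  | i + 1, ⟨⟨W, V⟩, rest⟩, x => NetWeights.eval i rest (block W V x)

namespace Timed

def trainFrom {d m k : ℕ} (lam η : ℝ) (T : ℕ) (Y : Fin m → ℝ) (ω : Init d k) :
    (i : ℕ) → i ≤ d → (Fin m → Fin (2 ^ i) → ℝ) → Timed (NetWeights k i)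
  | 0, _, _ => pure ()
  | i + 1, h, F => do
      let W₀ ← tabulate fun j => tabulate fun l => tabulate fun q => tick (ω.W ⟨i, h⟩ j l q)
      let V ← tabulate fun j => tabulate fun l => tick (ω.V ⟨i, h⟩ j l)
      let W ← trainLayer lam η T F Y V W₀
      let F' ← tabulate fun e => block W V (F e)
      let rest ← trainFrom lam η T Y ω i (Nat.le_of_succ_le h) F'
      pure ((W, V), rest)

/-- Layerwise gradient descent as a program that returns the weights of the network. -/
def layerwiseGD {d m k : ℕ} (lam η : ℝ) (T : ℕ) (S : Fin m → (Fin (2 ^ d) → ℤˣ) × ℤˣ)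
    (ω : Init d k) : Timed (NetWeights k d) := do
  let F ← tabulate fun e => tabulate fun j => tick (bit ((S e).1 j))
  let Y ← tabulate fun e => tick (bit (S e).2)
  trainFrom lam η T Y ω d le_rfl F

end Timed

end LayerwiseGD

end

noncomputable section

namespace LayerwiseGD

/-! ### Derivatives of the scalar functions -/

/-! While some gate of the trained layer is unsaturated on an example, the pooled prediction lies
strictly in (-1,1), so the derivative of the regularized loss there is the constant -(y + lam)
(`deriv_loss_of_unsaturated`). Hence gates do not interact: each is driven only by the empirical
correlations of y + lam with its four input patterns. Two patterns in {±1}² are equal, opposite or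
orthogonal, so a gate splits further into two independent systems, one for each pair {u, -u}
(`dot_lossGrad`, `PatternDynamics`).

In such a system, neurons whose output sign agrees with the target and that start active on u only
grow, until saturation; neurons of the wrong sign stay bounded by a small β on u. A potential
argument for u and -u together shows that after enough steps u is saturated with the right sign
(`PatternDynamics.saturated`). So a layer fed with exact bits outputs exact bits
(`block_trainLayer`), and induction over layers applies (`trainFrom_eq`).

The bit learned at a gate is the parity of the relevant inputs below it, times the sign of the mean
of that parity. With J the bits of I seen by the gate and R the other bits of I, the label is the
bit times an independent factor of mean ρ ≥ 0, so a pattern with target t has correlation (tρ +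
lam)·P(pattern). Since lam is ρ|E parity_J| + Δ/4, this has the sign of t with margin of order ξ²Δ
(`le_integral_pattern`); this is the purpose of the regularizer. Nonzero biases keep ρ, and the gap
of |E parity_J| below 1, away from zero. At the root the learned sign is s.

Randomness enters twice: Hoeffding transfers the correlations to the sample
(`measureReal_bad_sample_le`), and every gate needs a correctly signed active neuron for each
pattern (`measureReal_bad_init_le`). `failure_bound` combines both. The running time follows from
exact step counts and closure properties of polynomial bounds, using that Δ⁻¹ is a power of n. -/

theorem deriv_eq_zero_of_kink {f : ℝ → ℝ} {x a b : ℝ} (hl : HasDerivWithinAt f a (Set.Iic x) x)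
    (hr : HasDerivWithinAt f b (Set.Ici x) x) (hab : a ≠ b) : deriv f x = 0 := by
  -- `deriv` has the default value 0 where there is no derivative, which is the convention at kinks.
  refine deriv_zero_of_not_differentiableAt fun h => hab ?_
  have h₁ := (uniqueDiffWithinAt_Iic x).eq_deriv _ hl h.hasDerivAt.hasDerivWithinAt
  have h₂ := (uniqueDiffWithinAt_Ici x).eq_deriv _ hr h.hasDerivAt.hasDerivWithinAt
  rw [h₁, h₂]

theorem deriv_relu (z : ℝ) : deriv relu z = if 0 < z then 1 else 0 := by
  rcases lt_trichotomy z 0 with h | rfl | h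
  · rw [if_neg h.not_gt]
    have : relu =ᶠ[nhds z] fun _ => 0 := by
      filter_upwards [Iio_mem_nhds h] with y hy
      exact max_eq_right (le_of_lt hy)
    rw [this.deriv_eq, deriv_const]
  · rw [if_neg (lt_irrefl _)]
    refine deriv_eq_zero_of_kink (a := 0) (b := 1) ?_ ?_ zero_ne_one
    · exact (hasDerivWithinAt_const _ _ 0).congr (fun y hy => max_eq_right hy) (max_eq_right le_rfl)
    · exact (hasDerivWithinAt_id _ _).congr (fun y hy => max_eq_left hy) (max_eq_right le_rfl)
  · rw [if_pos h]
    have : relu =ᶠ[nhds z] id := by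
      filter_upwards [Ioi_mem_nhds h] with y hy
      exact max_eq_left (le_of_lt hy)
    rw [this.deriv_eq, deriv_id]

theorem hardTanh_of_ge {z : ℝ} (h : 1 ≤ z) : hardTanh z = 1 := by
  rw [hardTanh, min_eq_right h]; norm_num

theorem hardTanh_of_le {z : ℝ} (h : z ≤ -1) : hardTanh z = -1 := by
  rw [hardTanh, min_eq_left (by linarith), max_eq_right h]

theorem hardTanh_of_mem {z : ℝ} (h₁ : -1 ≤ z) (h₂ : z ≤ 1) : hardTanh z = z := by
  rw [hardTanh, min_eq_left h₂, max_eq_left h₁]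

theorem neg_one_le_hardTanh (z : ℝ) : -1 ≤ hardTanh z := le_max_right _ _

theorem hardTanh_le_one (z : ℝ) : hardTanh z ≤ 1 := max_le (min_le_right _ _) (by norm_num)

theorem deriv_hardTanh (z : ℝ) : deriv hardTanh z = if -1 < z ∧ z < 1 then 1 else 0 := by
  rcases lt_trichotomy z (-1) with h | rfl | h
  · rw [if_neg fun h' => h.not_gt h'.1]
    have : hardTanh =ᶠ[nhds z] fun _ => -1 := by
      filter_upwards [Iio_mem_nhds h] with y hy
      exact hardTanh_of_le (le_of_lt hy)
    rw [this.deriv_eq, deriv_const]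
  · rw [if_neg fun h' => lt_irrefl _ h'.1]
    refine deriv_eq_zero_of_kink (a := 0) (b := 1) ?_ ?_ zero_ne_one
    · exact (hasDerivWithinAt_const _ _ (-1)).congr (fun y hy => hardTanh_of_le hy)
        (hardTanh_of_le le_rfl)
    · refine (hasDerivWithinAt_id _ _).congr_of_eventuallyEq ?_ (hardTanh_of_le le_rfl)
      filter_upwards [self_mem_nhdsWithin,
        mem_nhdsWithin_of_mem_nhds (Iio_mem_nhds (show (-1 : ℝ) < 1 by norm_num))] with y hy hy'
      exact hardTanh_of_mem hy (le_of_lt hy')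
  rcases lt_trichotomy z 1 with h' | rfl | h'
  · rw [if_pos ⟨h, h'⟩]
    have : hardTanh =ᶠ[nhds z] id := by
      filter_upwards [Ioo_mem_nhds h h'] with y hy
      exact hardTanh_of_mem (le_of_lt hy.1) (le_of_lt hy.2)
    rw [this.deriv_eq, deriv_id]
  · rw [if_neg fun h' => lt_irrefl _ h'.2]
    refine deriv_eq_zero_of_kink (a := 1) (b := 0) ?_ ?_ one_ne_zero
    · refine (hasDerivWithinAt_id _ _).congr_of_eventuallyEq ?_ (hardTanh_of_ge le_rfl)
      filter_upwards [self_mem_nhdsWithin,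
        mem_nhdsWithin_of_mem_nhds (Ioi_mem_nhds h)] with y hy hy'
      exact hardTanh_of_mem (le_of_lt hy') hy
    · exact (hasDerivWithinAt_const _ _ 1).congr (fun y hy => hardTanh_of_ge hy)
        (hardTanh_of_ge le_rfl)
  · rw [if_neg fun h'' => h'.not_gt h''.2]
    have : hardTanh =ᶠ[nhds z] fun _ => 1 := by
      filter_upwards [Ioi_mem_nhds h'] with y hy
      exact hardTanh_of_ge (le_of_lt hy)
    rw [this.deriv_eq, deriv_const]

theorem bit_one : bit 1 = 1 := by simp [bit]

theorem bit_neg_one : bit (-1) = -1 := by simp [bit]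

theorem bit_mul (a b : ℤˣ) : bit (a * b) = bit a * bit b := by simp [bit]

theorem bit_neg (a : ℤˣ) : bit (-a) = -bit a := by simp [bit]

theorem bit_eq_one_or (b : ℤˣ) : bit b = 1 ∨ bit b = -1 := by
  rcases Int.units_eq_one_or b with rfl | rfl
  · exact Or.inl bit_one
  · exact Or.inr bit_neg_one

theorem bit_mul_self (b : ℤˣ) : bit b * bit b = 1 := by
  rcases bit_eq_one_or b with h | h <;> rw [h] <;> norm_num

theorem abs_bit (b : ℤˣ) : |bit b| = 1 := by
  rcases bit_eq_one_or b with h | h <;> rw [h] <;> norm_num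

theorem deriv_hinge (b : ℤˣ) (z : ℝ) :
    deriv (hinge (bit b)) z = if bit b * z < 1 then -bit b else 0 := by
  have hb := bit_mul_self b
  have hlin : ∀ s, HasDerivWithinAt (fun x => 1 - bit b * x) (-bit b) s z := fun s => by
    simpa using (((hasDerivAt_id z).const_mul (bit b)).const_sub 1).hasDerivWithinAt
  have hpos : ∀ {x}, bit b * x ≤ 1 → hinge (bit b) x = 1 - bit b * x :=
    fun h => max_eq_left (by linarith)
  have hneg : ∀ {x}, 1 ≤ bit b * x → hinge (bit b) x = 0 := fun h => max_eq_right (by linarith)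
  have hc : Continuous fun x => bit b * x := continuous_const.mul continuous_id
  rcases lt_trichotomy (bit b * z) 1 with h | h | h
  · rw [if_pos h]
    have : hinge (bit b) =ᶠ[nhds z] fun x => 1 - bit b * x := by
      filter_upwards [(isOpen_Iio.preimage hc).mem_nhds h] with y hy
      exact hpos (le_of_lt hy)
    rw [this.deriv_eq]
    exact ((hlin Set.univ).hasDerivAt Filter.univ_mem).deriv
  · rw [if_neg h.not_lt]
    -- The label decides on which side of the kink the hinge is flat.
    rcases bit_eq_one_or b with hb' | hb' <;> rw [hb'] at hpos hneg hlin h ⊢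
    · refine deriv_eq_zero_of_kink (a := -1) (b := 0) ?_ ?_ (by norm_num)
      · exact (hlin _).congr (fun y hy => hpos (by have : y ≤ z := hy; linarith)) (hpos h.le)
      · exact (hasDerivWithinAt_const _ _ 0).congr
          (fun y hy => hneg (by have : z ≤ y := hy; linarith)) (hneg h.ge)
    · refine deriv_eq_zero_of_kink (a := 0) (b := - -1) ?_ ?_ (by norm_num)
      · exact (hasDerivWithinAt_const _ _ 0).congr
          (fun y hy => hneg (by have : y ≤ z := hy; linarith)) (hneg h.ge)
      · exact (hlin _).congr (fun y hy => hpos (by have : z ≤ y := hy; linarith)) (hpos h.le)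
  · rw [if_neg h.not_gt]
    have : hinge (bit b) =ᶠ[nhds z] fun _ => 0 := by
      filter_upwards [(isOpen_Ioi.preimage hc).mem_nhds h] with y hy
      exact hneg (le_of_lt hy)
    rw [this.deriv_eq, deriv_const]

theorem deriv_reg (lam z : ℝ) :
    deriv (reg lam) z = if z < 1 then -lam else if 1 < z then lam else 0 := by
  have hl : ∀ {x}, x ≤ 1 → reg lam x = lam * (1 - x) := fun {x} h => by
    rw [reg, abs_of_nonneg (by linarith)]
  have hr : ∀ {x}, 1 ≤ x → reg lam x = lam * (x - 1) := fun {x} h => by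
    rw [reg, abs_of_nonpos (by linarith)]; ring
  have hdl : ∀ s, HasDerivWithinAt (fun x => lam * (1 - x)) (-lam) s z := fun s => by
    simpa using (((hasDerivAt_id z).const_sub 1).const_mul lam).hasDerivWithinAt
  have hdr : ∀ s, HasDerivWithinAt (fun x => lam * (x - 1)) lam s z := fun s => by
    simpa using (((hasDerivAt_id z).sub_const 1).const_mul lam).hasDerivWithinAt
  rcases lt_trichotomy z 1 with h | rfl | h
  · rw [if_pos h]
    have : reg lam =ᶠ[nhds z] fun x => lam * (1 - x) := by
      filter_upwards [Iio_mem_nhds h] with y hy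
      exact hl (le_of_lt hy)
    rw [this.deriv_eq]
    exact ((hdl Set.univ).hasDerivAt Filter.univ_mem).deriv
  · rw [if_neg (lt_irrefl _), if_neg (lt_irrefl _)]
    -- For `lam = 0` there is no kink; the derivative vanishes for the trivial reason.
    by_cases h0 : lam = 0
    · have : reg lam = fun _ => 0 := by funext x; simp [reg, h0]
      rw [this, deriv_const]
    · refine deriv_eq_zero_of_kink (a := -lam) (b := lam) ?_ ?_ fun h => h0 (by linarith)
      · exact (hdl _).congr (fun y hy => hl hy) (hl le_rfl)
      · exact (hdr _).congr (fun y hy => hr hy) (hr le_rfl)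
  · rw [if_neg h.not_gt, if_pos h]
    have : reg lam =ᶠ[nhds z] fun x => lam * (x - 1) := by
      filter_upwards [Ioi_mem_nhds h] with y hy
      exact hr (le_of_lt hy)
    rw [this.deriv_eq]
    exact ((hdr Set.univ).hasDerivAt Filter.univ_mem).deriv

/-! ### The program computes the network, and its number of steps -/

namespace Timed

theorem steps_pure {α : Type} (a : α) : (pure a : Timed α).steps = 0 := rfl

theorem val_bind {α β : Type} (a : Timed α) (f : α → Timed β) : (a >>= f).val = (f a.val).val := rfl

theorem steps_bind {α β : Type} (a : Timed α) (f : α → Timed β) :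
    (a >>= f).steps = a.steps + (f a.val).steps := rfl

theorem val_tick {α : Type} (a : α) : (tick a).val = a := rfl

theorem steps_tick {α : Type} (a : α) : (tick a).steps = 1 := rfl

theorem val_tabulate {α : Type} {n : ℕ} (f : Fin n → Timed α) :
    (tabulate f).val = fun j => (f j).val := rfl

theorem steps_tabulate {α : Type} {n : ℕ} (f : Fin n → Timed α) :
    (tabulate f).steps = n + ∑ j, (f j).steps := rfl

theorem val_sum {n : ℕ} (f : Fin n → Timed ℝ) : (sum f).val = ∑ j, (f j).val := rfl

theorem steps_sum {n : ℕ} (f : Fin n → Timed ℝ) : (sum f).steps = n + ∑ j, (f j).steps := rfl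

theorem val_loop {α : Type} (f : α → Timed α) (T : ℕ) (a : α) :
    (loop f T a).val = (fun a => (f a).val)^[T] a := by
  induction T generalizing a with
  | zero => rfl
  | succ T ih => exact ih _

theorem steps_loop {α : Type} (f : α → Timed α) {c : ℕ} (hc : ∀ a, (f a).steps = c) (T : ℕ)
    (a : α) : (loop f T a).steps = T * (c + 1) := by
  induction T generalizing a with
  | zero => simp [loop, steps_pure]
  | succ T ih =>
    rw [loop, steps_bind, steps_bind, hc, ih, steps_tick]
    ring

theorem val_dot (w x : Fin 2 → ℝ) : (dot w x).val = LayerwiseGD.dot w x := rfl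

theorem steps_dot (w x : Fin 2 → ℝ) : (dot w x).steps = 4 := by
  simp [dot, steps_sum, steps_tick]

theorem val_preAct {k : ℕ} (w : Fin k → Fin 2 → ℝ) (v : Fin k → ℝ) (x : Fin 2 → ℝ) :
    (preAct w v x).val = LayerwiseGD.preAct w v x := rfl

theorem steps_preAct {k : ℕ} (w : Fin k → Fin 2 → ℝ) (v : Fin k → ℝ) (x : Fin 2 → ℝ) :
    (preAct w v x).steps = 7 * k := by
  simp [preAct, steps_sum, steps_bind, steps_tick, steps_dot, relu]
  ring

theorem val_inputPair {i : ℕ} (x : Fin (2 ^ (i + 1)) → ℝ) (j : Fin (2 ^ i)) :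
    (inputPair x j).val = LayerwiseGD.inputPair x j := rfl

theorem steps_inputPair {i : ℕ} (x : Fin (2 ^ (i + 1)) → ℝ) (j : Fin (2 ^ i)) :
    (inputPair x j).steps = 4 := by
  simp [inputPair, steps_tabulate, steps_tick]

theorem val_block {i k : ℕ} (W : LayerW i k) (V : LayerV i k) (x : Fin (2 ^ (i + 1)) → ℝ) :
    (block W V x).val = LayerwiseGD.block W V x := rfl

theorem steps_block {i k : ℕ} (W : LayerW i k) (V : LayerV i k) (x : Fin (2 ^ (i + 1)) → ℝ) :
    (block W V x).steps = 2 ^ i * (7 * k + 7) := by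
  simp [block, steps_tabulate, steps_bind, steps_inputPair, steps_preAct, hardTanh, steps_tick]
  ring

theorem val_count (n : ℕ) : (count n).val = n := by
  simp [count, val_sum, val_tick]

theorem steps_count (n : ℕ) : (count n).steps = 2 * n := by
  simp [count, steps_sum, steps_tick]
  ring

theorem val_lossDeriv (lam : ℝ) (y : ℤˣ) (z : ℝ) :
    (lossDeriv lam (bit y) z).val = deriv (hinge (bit y)) z + deriv (reg lam) z := by
  rw [deriv_hinge, deriv_reg]
  rfl

theorem steps_lossDeriv (lam y z : ℝ) : (lossDeriv lam y z).steps = 7 := rfl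

theorem val_reluDeriv (z : ℝ) : (reluDeriv z).val = deriv LayerwiseGD.relu z := by
  rw [deriv_relu]
  rfl

theorem val_hardTanhDeriv (z : ℝ) : (hardTanhDeriv z).val = deriv LayerwiseGD.hardTanh z := by
  rw [deriv_hardTanh]
  change (if z < 1 then if -1 < z then (1 : ℝ) else 0 else 0) = _
  split_ifs <;> grind

theorem val_lossGrad {n m i k : ℕ} (lam : ℝ) (S : Fin m → (Fin n → ℤˣ) × ℤˣ)
    (N : (Fin n → ℝ) → (Fin (2 ^ (i + 1)) → ℝ)) (V : LayerV i k) (W : LayerW i k) :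
    (lossGrad lam (fun e => N (realInput (S e).1)) (fun e => bit (S e).2) V W).val =
      LayerwiseGD.lossGrad lam S N V W := by
  funext j l q
  simp only [lossGrad, val_bind, val_tabulate, val_sum, val_tick, val_count, val_block,
    val_lossDeriv, val_hardTanhDeriv, val_reluDeriv, val_preAct, val_dot, val_inputPair,
    LayerwiseGD.lossGrad, avgPool]
  rw [div_eq_mul_one_div, mul_comm]
  congr 1
  refine Finset.sum_congr rfl fun e _ => ?_
  rw [div_eq_mul_one_div (∑ j, LayerwiseGD.block W V (N (realInput (S e).1)) j), mul_comm (∑ j, _)]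
  ring

theorem steps_lossGrad {m i k : ℕ} (lam : ℝ) (F : Fin m → Fin (2 ^ (i + 1)) → ℝ) (Y : Fin m → ℝ)
    (V : LayerV i k) (W : LayerW i k) :
    (lossGrad lam F Y V W).steps = 2 * m + 2 * 2 ^ i + m * (2 ^ i * (7 * k + 9) + 10) +
      2 ^ i * (1 + k * (3 + 2 * (m * (7 * k + 16) + 1))) := by
  simp [lossGrad, steps_bind, steps_tabulate, steps_sum, steps_tick, steps_count, steps_block,
    steps_lossDeriv, steps_inputPair, steps_preAct, steps_dot, hardTanhDeriv, reluDeriv]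
  ring

theorem val_trainLayer {n m i k : ℕ} (lam η : ℝ) (T : ℕ) (S : Fin m → (Fin n → ℤˣ) × ℤˣ)
    (N : (Fin n → ℝ) → (Fin (2 ^ (i + 1)) → ℝ)) (V : LayerV i k) (W₀ : LayerW i k) :
    (trainLayer lam η T (fun e => N (realInput (S e).1)) (fun e => bit (S e).2) V W₀).val =
      LayerwiseGD.trainLayer lam η T S N V W₀ := by
  rw [trainLayer, val_loop, LayerwiseGD.trainLayer]
  congr 2
  funext W
  rw [← val_lossGrad]
  rfl

theorem steps_trainLayer {m i k : ℕ} (lam η : ℝ) (T : ℕ) (F : Fin m → Fin (2 ^ (i + 1)) → ℝ)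
    (Y : Fin m → ℝ) (V : LayerV i k) (W₀ : LayerW i k) :
    (trainLayer lam η T F Y V W₀).steps = T * (2 * m + 2 * 2 ^ i +
      m * (2 ^ i * (7 * k + 9) + 10) + 2 ^ i * (1 + k * (3 + 2 * (m * (7 * k + 16) + 1))) +
      2 ^ i * (1 + 7 * k) + 1) := by
  rw [trainLayer]
  refine steps_loop _ (fun W => ?_) T W₀
  simp [steps_bind, steps_tabulate, steps_tick, steps_lossGrad]
  ring

/-- The gradient sees the lower layers only through their values at the sample points. Hence the
program may store these values instead of the function `N`. -/
theorem eval_trainFrom {d m k : ℕ} (lam η : ℝ) (T : ℕ) (S : Fin m → (Fin (2 ^ d) → ℤˣ) × ℤˣ)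
    (ω : Init d k) (i : ℕ) (h : i ≤ d) (N : (Fin (2 ^ d) → ℝ) → (Fin (2 ^ i) → ℝ))
    (x : Fin (2 ^ d) → ℝ) :
    NetWeights.eval i (trainFrom lam η T (fun e => bit (S e).2) ω i h
      (fun e => N (realInput (S e).1))).val (N x) = LayerwiseGD.trainFrom lam η T S ω i h N x := by
  induction i with
  | zero => rfl
  | succ i ih =>
    rw [LayerwiseGD.trainFrom, ← ih, ← val_trainLayer]
    rfl

theorem steps_trainFrom_le {d m k : ℕ} (lam η : ℝ) (T : ℕ) (Y : Fin m → ℝ) (ω : Init d k)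
    (i : ℕ) (h : i ≤ d) (F : Fin m → Fin (2 ^ i) → ℝ) :
    (trainFrom lam η T Y ω i h F).steps ≤
      i * (100 * 2 ^ d * (m + 1) * (T + 1) * (k + 1) ^ 2) := by
  induction i with
  | zero => exact Nat.zero_le _
  | succ i ih =>
    obtain ⟨W, V, W₀, F', h'⟩ : ∃ (W : LayerW i k) (V : LayerV i k) (W₀ : LayerW i k)
        (F' : Fin m → Fin (2 ^ i) → ℝ), (trainFrom lam η T Y ω (i + 1) h F).steps =
        (tabulate fun j => tabulate fun l => tabulate fun q => tick (ω.W ⟨i, h⟩ j l q)).steps +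
        ((tabulate fun j => tabulate fun l => tick (ω.V ⟨i, h⟩ j l)).steps +
        ((trainLayer lam η T F Y V W₀).steps + ((tabulate fun e => block W V (F e)).steps +
        ((trainFrom lam η T Y ω i (Nat.le_of_succ_le h) F').steps + 0)))) := ⟨_, _, _, _, rfl⟩
    have ih' := ih (Nat.le_of_succ_le h) F'
    have hp : 2 ^ i ≤ 2 ^ d := Nat.pow_le_pow_right two_pos (Nat.le_of_succ_le h)
    have h1 : 1 ≤ 2 ^ i := Nat.one_le_two_pow
    rw [h', Nat.succ_mul]
    simp only [steps_tabulate, steps_tick, steps_trainLayer, steps_block, Finset.sum_const,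
      Finset.card_univ, Fintype.card_fin, smul_eq_mul]
    clear h' ih
    have hmain : ∀ a : ℕ, 1 ≤ a → a + a * (k + k * (2 + 2 * 1)) + (a + a * (k + k * 1) +
        (T * (2 * m + 2 * a + m * (a * (7 * k + 9) + 10) +
          a * (1 + k * (3 + 2 * (m * (7 * k + 16) + 1))) + a * (1 + 7 * k) + 1) +
        (m + m * (a * (7 * k + 7))))) ≤ 100 * a * (m + 1) * (T + 1) * (k + 1) ^ 2 := by
      intro a ha
      -- After the shift `a = a' + 1` the difference of the two sides is a polynomial with
      -- nonnegative coefficients, so `positivity` applies.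
      obtain ⟨a, rfl⟩ := Nat.exists_eq_add_of_le' ha
      zify
      rw [← sub_nonneg]
      ring_nf
      positivity
    have hle : 100 * 2 ^ i * (m + 1) * (T + 1) * (k + 1) ^ 2 ≤
        100 * 2 ^ d * (m + 1) * (T + 1) * (k + 1) ^ 2 := by gcongr
    have := hmain _ h1
    omega

theorem eval_layerwiseGD {d m k : ℕ} (lam η : ℝ) (T : ℕ) (S : Fin m → (Fin (2 ^ d) → ℤˣ) × ℤˣ)
    (ω : Init d k) : NetWeights.eval d (layerwiseGD lam η T S ω).val =
      LayerwiseGD.layerwiseGD lam η T S ω := by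
  funext x
  exact eval_trainFrom lam η T S ω d le_rfl id x

theorem steps_layerwiseGD_le {d m k : ℕ} (lam η : ℝ) (T : ℕ)
    (S : Fin m → (Fin (2 ^ d) → ℤˣ) × ℤˣ) (ω : Init d k) :
    (layerwiseGD lam η T S ω).steps ≤
      (d + 1) * (100 * 2 ^ d * (m + 1) * (T + 1) * (k + 1) ^ 2) := by
  have h := steps_trainFrom_le lam η T (fun e => bit (S e).2) ω d le_rfl
    (fun e j => bit ((S e).1 j))
  have h' : (layerwiseGD lam η T S ω).steps =
      (tabulate fun e => tabulate fun j => tick (bit ((S e).1 j))).steps +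
      ((tabulate fun e => tick (bit (S e).2)).steps +
      (trainFrom lam η T (fun e => bit (S e).2) ω d le_rfl (fun e j => bit ((S e).1 j))).steps) :=
    rfl
  rw [h', Nat.succ_mul]
  simp only [steps_tabulate, steps_tick, Finset.sum_const, Finset.card_univ, Fintype.card_fin,
    smul_eq_mul]
  have hmain : ∀ a : ℕ, 1 ≤ a → m + m * (a + a * 1) + (m + m * 1) ≤
      100 * a * (m + 1) * (T + 1) * (k + 1) ^ 2 := by
    intro a ha
    obtain ⟨a, rfl⟩ := Nat.exists_eq_add_of_le' ha
    zify
    rw [← sub_nonneg]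
    ring_nf
    positivity
  have := hmain (2 ^ d) Nat.one_le_two_pow
  omega

end Timed

/-! ### Polynomial bounds -/

/-- A nonnegative quantity that is bounded by a polynomial in `n log (1 / δ)`, for `n = 2 ^ d`. -/
def PolyBounded (f : ℕ → ℝ → ℝ) : Prop :=
  ∃ (C : ℝ) (a : ℕ), ∀ d, 1 ≤ d → ∀ δ, 0 < δ → δ < 1 / 2 →
    0 ≤ f d δ ∧ f d δ ≤ C * ((2 : ℝ) ^ d * Real.log (1 / δ)) ^ a

theorem half_lt_log_inv {δ : ℝ} (h₀ : 0 < δ) (h₁ : δ < 1 / 2) : 1 / 2 < Real.log (1 / δ) := by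
  have h : Real.log 2 ≤ Real.log (1 / δ) := by
    refine Real.log_le_log two_pos ?_
    rw [le_div_iff₀ h₀]
    linarith
  have := Real.log_two_gt_d9
  linarith

/-- Powers of a base that is at least 1 increase with the exponent; this allows bounds of different
degrees to be merged. -/
theorem one_le_scale {d : ℕ} (hd : 1 ≤ d) {δ : ℝ} (h₀ : 0 < δ) (h₁ : δ < 1 / 2) :
    1 ≤ (2 : ℝ) ^ d * Real.log (1 / δ) := by
  have h := half_lt_log_inv h₀ h₁
  have h2 : (2 : ℝ) ^ 1 ≤ 2 ^ d := pow_le_pow_right₀ one_le_two hd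
  nlinarith

namespace PolyBounded

theorem exists_nonneg {f : ℕ → ℝ → ℝ} (hf : PolyBounded f) :
    ∃ (C : ℝ) (a : ℕ), 0 ≤ C ∧ ∀ d, 1 ≤ d → ∀ δ, 0 < δ → δ < 1 / 2 →
    0 ≤ f d δ ∧ f d δ ≤ C * ((2 : ℝ) ^ d * Real.log (1 / δ)) ^ a := by
  obtain ⟨C, a, h⟩ := hf
  refine ⟨|C|, a, abs_nonneg C, fun d hd δ h₀ h₁ => ⟨(h d hd δ h₀ h₁).1, ?_⟩⟩
  refine (h d hd δ h₀ h₁).2.trans ?_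
  have := one_le_scale hd h₀ h₁
  gcongr
  exact le_abs_self C

theorem mono {f g : ℕ → ℝ → ℝ} (hg : PolyBounded g) (h₀ : ∀ d, 1 ≤ d → ∀ δ, 0 < δ → δ < 1 / 2 →
    0 ≤ f d δ ∧ f d δ ≤ g d δ) : PolyBounded f := by
  obtain ⟨C, a, h⟩ := hg
  exact ⟨C, a, fun d hd δ h1 h2 => ⟨(h₀ d hd δ h1 h2).1,
    (h₀ d hd δ h1 h2).2.trans (h d hd δ h1 h2).2⟩⟩

theorem const {c : ℝ} (hc : 0 ≤ c) : PolyBounded fun _ _ => c :=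
  ⟨c, 0, fun d _ δ _ _ => ⟨hc, by simp⟩⟩

theorem add {f g : ℕ → ℝ → ℝ} (hf : PolyBounded f) (hg : PolyBounded g) :
    PolyBounded fun d δ => f d δ + g d δ := by
  obtain ⟨C, a, hC, h⟩ := hf.exists_nonneg
  obtain ⟨D, b, hD, h'⟩ := hg.exists_nonneg
  refine ⟨C + D, a + b, fun d hd δ h₀ h₁ => ?_⟩
  have hX := one_le_scale hd h₀ h₁
  have h1 := h d hd δ h₀ h₁
  have h2 := h' d hd δ h₀ h₁
  refine ⟨add_nonneg h1.1 h2.1, (add_le_add h1.2 h2.2).trans ?_⟩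
  rw [add_mul]
  gcongr <;> first | exact hX | omega

theorem mul {f g : ℕ → ℝ → ℝ} (hf : PolyBounded f) (hg : PolyBounded g) :
    PolyBounded fun d δ => f d δ * g d δ := by
  obtain ⟨C, a, hC, h⟩ := hf.exists_nonneg
  obtain ⟨D, b, hD, h'⟩ := hg.exists_nonneg
  refine ⟨C * D, a + b, fun d hd δ h₀ h₁ => ?_⟩
  have hX := one_le_scale hd h₀ h₁
  have h1 := h d hd δ h₀ h₁
  have h2 := h' d hd δ h₀ h₁
  refine ⟨mul_nonneg h1.1 h2.1, (mul_le_mul h1.2 h2.2 h2.1 (h1.1.trans h1.2)).trans ?_⟩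
  rw [pow_add]
  apply le_of_eq
  ring

theorem pow {f : ℕ → ℝ → ℝ} (hf : PolyBounded f) (b : ℕ) :
    PolyBounded fun d δ => f d δ ^ b := by
  induction b with
  | zero => simpa using const zero_le_one
  | succ b ih => simpa only [pow_succ] using ih.mul hf

theorem two_pow : PolyBounded fun d _ => (2 : ℝ) ^ d := by
  refine ⟨2, 1, fun d hd δ h₀ h₁ => ⟨by positivity, ?_⟩⟩
  have := half_lt_log_inv h₀ h₁
  have h2 : (0 : ℝ) < 2 ^ d := by positivity
  nlinarith

theorem log_inv : PolyBounded fun _ δ => Real.log (1 / δ) := by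
  refine ⟨1, 1, fun d hd δ h₀ h₁ => ?_⟩
  have := half_lt_log_inv h₀ h₁
  have h2 : (1 : ℝ) ≤ 2 ^ d := one_le_pow₀ one_le_two
  exact ⟨by linarith, by nlinarith⟩

theorem depth : PolyBounded fun d _ => (d : ℝ) :=
  two_pow.mono fun d _ _ _ _ => ⟨by positivity, by exact_mod_cast d.lt_two_pow_self.le⟩

/-- If `1 / c < 2 ^ b`, then `1 / c ^ d ≤ (2 ^ d) ^ b`. This is where depth log n makes Δ⁻¹
polynomial in n, with an exponent depending on ξ. -/
theorem inv_pow {c : ℝ} (hc : 0 < c) : PolyBounded fun d _ => 1 / c ^ d := by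
  obtain ⟨b, hb⟩ := pow_unbounded_of_one_lt (1 / c) one_lt_two
  refine (two_pow.pow b).mono fun d _ _ _ _ => ⟨by positivity, ?_⟩
  rw [← pow_mul, mul_comm, pow_mul, ← one_div_pow]
  gcongr

theorem log_div {c : ℝ} (hc : 1 ≤ c) : PolyBounded fun d δ => Real.log (c * 2 ^ d * d / δ) := by
  refine (((const (zero_le_one.trans hc)).mul two_pow).mul depth |>.add log_inv).mono
    fun d hd δ h₀ h₁ => ?_
  have hd' : (1 : ℝ) ≤ d := by exact_mod_cast hd
  have h2 : (1 : ℝ) ≤ 2 ^ d := one_le_pow₀ one_le_two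
  have h3 : 1 ≤ c * 2 ^ d * d := by
    have := one_le_mul_of_one_le_of_one_le hc h2
    exact one_le_mul_of_one_le_of_one_le this hd'
  have h4 := half_lt_log_inv h₀ h₁
  have h5 : Real.log (c * 2 ^ d * d / δ) = Real.log (c * 2 ^ d * d) + Real.log (1 / δ) := by
    rw [← Real.log_mul (by positivity) (by positivity)]
    congr 1
    ring
  have h6 := Real.log_nonneg h3
  rw [h5]
  exact ⟨by linarith, by linarith [Real.log_le_self (zero_le_one.trans h3)]⟩

end PolyBounded

/-- Parameters that satisfy the conditions of the theorem and are polynomial in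
`n log (1 / δ)`. -/
theorem exists_admissible_polyBounded {ξ : ℝ} (hξ : 0 < ξ) :
    ∃ (C : ℝ) (a : ℕ), ∀ d, 1 ≤ d → ∀ δ, 0 < δ → δ < 1 / 2 →
      ∃ (k m T : ℕ) (η : ℝ), Admissible ξ δ d k m T η ∧
        (m : ℝ) ≤ C * ((2 : ℝ) ^ d * Real.log (1 / δ)) ^ a ∧
        (((d + 1) * (100 * 2 ^ d * (m + 1) * (T + 1) * (k + 1) ^ 2) : ℕ) : ℝ) ≤
          C * ((2 : ℝ) ^ d * Real.log (1 / δ)) ^ a := by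
  let L : ℕ → ℝ → ℝ := fun d δ => Real.log (2 * 2 ^ d * d / δ) / Real.log (4 / 3)
  let k : ℕ → ℝ → ℕ := fun d δ => ⌈L d δ⌉₊ + 1
  let M : ℕ → ℝ → ℝ := fun d δ =>
    2 ^ 11 / ((ξ ^ 2) ^ 2 * ((2 * ξ) ^ d) ^ 2) * Real.log (8 * 2 ^ d * d / δ)
  let m : ℕ → ℝ → ℕ := fun d δ => ⌊M d δ⌋₊ + 1
  let η : ℕ → ℝ → ℝ := fun d δ => 1 / (16 * √2 * k d δ)
  let R : ℕ → ℝ → ℝ := fun d δ => 6 * 2 ^ d / (√2 * η d δ * ξ ^ 2 * (2 * ξ) ^ d)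
  let T : ℕ → ℝ → ℕ := fun d δ => ⌊R d δ⌋₊ + 1
  have hlog : 0 < Real.log (4 / 3) := Real.log_pos (by norm_num)
  have hΔ : PolyBounded fun d _ => 1 / (2 * ξ) ^ d := PolyBounded.inv_pow (by positivity)
  have hL : PolyBounded L := by
    refine ((PolyBounded.const (inv_nonneg.2 hlog.le)).mul
      (PolyBounded.log_div one_le_two)).mono fun d hd δ h₀ h₁ => ?_
    obtain ⟨C, a, h⟩ := PolyBounded.log_div one_le_two
    exact ⟨div_nonneg (h d hd δ h₀ h₁).1 hlog.le, le_of_eq (div_eq_inv_mul _ _)⟩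
  have hL0 : ∀ d, 1 ≤ d → ∀ δ, 0 < δ → δ < 1 / 2 → 0 ≤ L d δ := fun d hd δ h₀ h₁ => by
    obtain ⟨C, a, h⟩ := hL
    exact (h d hd δ h₀ h₁).1
  have hk : PolyBounded fun d δ => (k d δ : ℝ) := by
    refine (hL.add (PolyBounded.const zero_le_two)).mono fun d hd δ h₀ h₁ => ⟨by positivity, ?_⟩
    have := Nat.ceil_lt_add_one (hL0 d hd δ h₀ h₁)
    simp only [k]
    push_cast
    linarith
  have hM : PolyBounded M := by
    refine (((PolyBounded.const (c := 2 ^ 11 / (ξ ^ 2) ^ 2) (by positivity)).mul (hΔ.pow 2)).mul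
      (PolyBounded.log_div (c := 8) (by norm_num))).mono fun d hd δ h₀ h₁ => ?_
    obtain ⟨C, a, h⟩ := PolyBounded.log_div (c := 8) (by norm_num)
    have h8 := (h d hd δ h₀ h₁).1
    refine ⟨mul_nonneg (by positivity) h8, le_of_eq ?_⟩
    simp only [M]
    rw [div_pow, one_pow, div_mul_div_comm, mul_one]
  have hM0 : ∀ d, 1 ≤ d → ∀ δ, 0 < δ → δ < 1 / 2 → 0 ≤ M d δ := fun d hd δ h₀ h₁ => by
    obtain ⟨C, a, h⟩ := hM
    exact (h d hd δ h₀ h₁).1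
  have hm : PolyBounded fun d δ => (m d δ : ℝ) := by
    refine (hM.add (PolyBounded.const zero_le_one)).mono fun d hd δ h₀ h₁ => ⟨by positivity, ?_⟩
    have := Nat.floor_le (hM0 d hd δ h₀ h₁)
    simp only [m]
    push_cast
    linarith
  have hk0 : ∀ d δ, (0 : ℝ) < k d δ := fun d δ => by
    simp only [k]
    positivity
  -- The largest allowed rate gives `√2 * η = 1 / (16 * k)`, and 6 · 16 = 96.
  have hR : ∀ d δ, R d δ = 96 / ξ ^ 2 * k d δ * 2 ^ d * (1 / (2 * ξ) ^ d) := fun d δ => by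
    have := hk0 d δ
    simp only [R, η]
    field_simp
    norm_num
  have hRb : PolyBounded R := by
    refine ((((PolyBounded.const (c := 96 / ξ ^ 2) (by positivity)).mul hk).mul
      PolyBounded.two_pow).mul hΔ).mono fun d hd δ h₀ h₁ => ⟨?_, (hR d δ).le⟩
    rw [hR]
    positivity
  have hT : PolyBounded fun d δ => (T d δ : ℝ) := by
    refine (hRb.add (PolyBounded.const zero_le_one)).mono fun d hd δ h₀ h₁ => ⟨by positivity, ?_⟩
    have : 0 ≤ R d δ := by rw [hR]; positivity
    have := Nat.floor_le this
    simp only [T]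
    push_cast
    linarith
  have h1 := PolyBounded.const zero_le_one
  -- Bounding the sum of sample size and step count yields one pair `C`, `a` that serves both.
  obtain ⟨C, a, h⟩ := hm.add ((PolyBounded.depth.add h1).mul (((((PolyBounded.const
    (c := 100) (by norm_num)).mul PolyBounded.two_pow).mul (hm.add h1)).mul (hT.add h1)).mul
    ((hk.add h1).pow 2)))
  refine ⟨C, a, fun d hd δ h₀ h₁ => ⟨k d δ, m d δ, T d δ, η d δ, ?_, ?_, ?_⟩⟩
  · have := hk0 d δ
    refine ⟨?_, ?_, le_rfl, ?_, ?_⟩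
    · refine (Nat.le_ceil (L d δ)).trans ?_
      simp only [k]
      push_cast
      linarith
    · simp only [η]
      positivity
    · simpa only [m, Nat.cast_add, Nat.cast_one] using Nat.lt_floor_add_one (M d δ)
    · simpa only [T, Nat.cast_add, Nat.cast_one] using Nat.lt_floor_add_one (R d δ)
  · refine le_trans ?_ (h d hd δ h₀ h₁).2
    have : (0 : ℝ) ≤ (d + 1) * (100 * 2 ^ d * (m d δ + 1) * (T d δ + 1) * (k d δ + 1) ^ 2) := by
      positivity
    linarith
  · refine le_trans ?_ (h d hd δ h₀ h₁).2
    push_cast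
    have : (0 : ℝ) ≤ m d δ := by positivity
    linarith

/-! ### The dynamics of one gate along a pair of opposite patterns -/

/-- The correlations of the neurons of a gate with a pattern: `cp` and `cm` are the speeds caused
by the pattern and by its opposite, each of which acts on the neurons that it activates, as long as
the output of the gate is not saturated. -/
def PatternDynamics {k : ℕ} (v : Fin k → ℤˣ) (cp cm : ℝ) (a : ℕ → Fin k → ℝ) : Prop :=
  ∀ t l, a (t + 1) l = a t l + bit (v l) *
    (cp * (deriv hardTanh (∑ r, bit (v r) * relu (a t r)) * if 0 < a t l then 1 else 0) -
      cm * (deriv hardTanh (∑ r, bit (v r) * relu (-a t r)) * if a t l < 0 then 1 else 0))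

namespace PatternDynamics

variable {k : ℕ} {v : Fin k → ℤˣ} {cp cm : ℝ} {a : ℕ → Fin k → ℝ}

/-- The symmetry u ↔ -u: every estimate for a pattern also holds for its opposite. -/
theorem neg (h : PatternDynamics v cp cm a) : PatternDynamics v cm cp (-a) := by
  intro t l
  have := h t l
  simp only [Pi.neg_apply, neg_neg, Left.neg_pos_iff, Left.neg_neg_iff] at this ⊢
  rw [this]
  ring

theorem deriv_hardTanh_nonneg (z : ℝ) : 0 ≤ deriv hardTanh z := by
  rw [deriv_hardTanh]
  split_ifs <;> norm_num

theorem deriv_hardTanh_le_one (z : ℝ) : deriv hardTanh z ≤ 1 := by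
  rw [deriv_hardTanh]
  split_ifs <;> norm_num

/-- While positive, a neuron of the wrong sign is only pushed down, by its own pattern. The opposite
pattern can push it up only while it is negative, and then by at most `|cm|`, so it never overshoots
`β`. -/
theorem le_of_bad (h : PatternDynamics v cp cm a) {β : ℝ} {sp : ℤˣ} (hp : 0 ≤ bit sp * cp)
    (hm : |cm| ≤ β) (h₀ : ∀ l, |a 0 l| ≤ β) {l : Fin k} (hl : v l ≠ sp) (t : ℕ) : a t l ≤ β := by
  have hv : bit (v l) = -bit sp := by
    rw [← bit_neg]
    congr 1
    rcases Int.units_eq_one_or (v l) with h | h <;> rcases Int.units_eq_one_or sp with h' | h' <;>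
      simp_all
  induction t with
  | zero => exact (le_abs_self _).trans (h₀ l)
  | succ t ih =>
    rw [h t l, hv]
    rcases lt_trichotomy (a t l) 0 with hs | hs | hs
    · rw [if_neg hs.not_gt, if_pos hs]
      have h1 := deriv_hardTanh_nonneg (∑ r, bit (v r) * relu (-a t r))
      have h2 := deriv_hardTanh_le_one (∑ r, bit (v r) * relu (-a t r))
      generalize deriv hardTanh (∑ r, bit (v r) * relu (-a t r)) = D at *
      have h3 : bit sp * cm * D ≤ β := by
        refine (le_abs_self _).trans ?_
        rw [abs_mul, abs_mul, abs_bit, one_mul, abs_of_nonneg h1]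
        exact (mul_le_of_le_one_right (abs_nonneg _) h2).trans hm
      linarith
    · rw [if_neg (by linarith), if_neg (by linarith)]
      linarith
    · rw [if_pos hs, if_neg hs.not_gt]
      have h1 := mul_nonneg hp (deriv_hardTanh_nonneg (∑ r, bit (v r) * relu (a t r)))
      linarith

/-- A neuron active on u is inactive on -u, so only its own pattern moves it. With the right sign
this motion is upward, hence activity persists. -/
theorem good_pos_and_succ (h : PatternDynamics v cp cm a) {sp : ℤˣ} (hp : 0 ≤ bit sp * cp)
    {l : Fin k} (hl : v l = sp) (h₀ : 0 < a 0 l) (t : ℕ) :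
    0 < a t l ∧ a (t + 1) l =
      a t l + bit sp * cp * deriv hardTanh (∑ r, bit (v r) * relu (a t r)) := by
  have key : ∀ t, 0 < a t l → a (t + 1) l =
      a t l + bit sp * cp * deriv hardTanh (∑ r, bit (v r) * relu (a t r)) := by
    intro t ht
    rw [h t l, if_pos ht, if_neg ht.not_gt, hl]
    ring
  have hpos : ∀ t, 0 < a t l := by
    intro t
    induction t with
    | zero => exact h₀
    | succ t ih =>
      rw [key t ih]
      exact add_pos_of_pos_of_nonneg ih (mul_nonneg hp (deriv_hardTanh_nonneg _))
  exact ⟨hpos t, key t (hpos t)⟩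

/-- In the direction of `sp`, neurons of the right sign contribute nonnegatively and each of the
others costs at most `β`. -/
theorem good_sub_le (h : PatternDynamics v cp cm a) {β : ℝ} (hβ : 0 ≤ β) {sp : ℤˣ}
    (hp : 0 ≤ bit sp * cp) (hm : |cm| ≤ β) (h₀ : ∀ l, |a 0 l| ≤ β) {l : Fin k} (hl : v l = sp)
    (t : ℕ) : a t l - k * β ≤ bit sp * ∑ r, bit (v r) * relu (a t r) := by
  have key : ∀ r, (if r = l then a t l else 0) - β ≤ bit sp * (bit (v r) * relu (a t r)) := by
    intro r
    have hrelu : 0 ≤ relu (a t r) := le_max_right _ _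
    by_cases hr : v r = sp
    · rw [hr, ← mul_assoc, bit_mul_self, one_mul]
      split_ifs with hrl
      · have : a t r ≤ relu (a t r) := le_max_left _ _
        rw [hrl] at this ⊢
        linarith
      · linarith
    · rw [if_neg (by rintro rfl; exact hr hl)]
      have hb := h.le_of_bad hp hm h₀ hr t
      have : relu (a t r) ≤ β := max_le hb hβ
      have hv : bit sp * bit (v r) = -1 := by
        rw [← bit_mul, ← bit_neg_one]
        congr 1
        rcases Int.units_eq_one_or (v r) with h | h <;>
          rcases Int.units_eq_one_or sp with h' | h' <;> simp_all
      rw [← mul_assoc, hv]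
      linarith
  have := Finset.sum_le_sum fun r (_ : r ∈ Finset.univ) => key r
  rw [← Finset.mul_sum] at this
  simpa using this

/-- Motion requires an unsaturated output, hence a value below 1 + kβ ≤ 3/2 by `good_sub_le`; one
step adds at most β ≤ 1/2. -/
theorem good_le_two (h : PatternDynamics v cp cm a) {β : ℝ} (hkβ : k * β ≤ 1 / 2) {sp : ℤˣ}
    (hp : 0 ≤ bit sp * cp) (hcp : |cp| ≤ β) (hm : |cm| ≤ β) (h₀ : ∀ l, |a 0 l| ≤ β) {l : Fin k}
    (hl : v l = sp) (hl₀ : 0 < a 0 l) (t : ℕ) : a t l ≤ 2 := by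
  have hβ : 0 ≤ β := (abs_nonneg cp).trans hcp
  have hk : (1 : ℝ) ≤ k := by exact_mod_cast l.pos
  have hβ' : β ≤ 1 / 2 := by nlinarith
  induction t with
  | zero => linarith [(le_abs_self _).trans (h₀ l)]
  | succ t ih =>
    rw [(h.good_pos_and_succ hp hl hl₀ t).2, deriv_hardTanh]
    have hsub := h.good_sub_le hβ hp hm h₀ hl t
    split_ifs with hact
    · have h1 : bit sp * ∑ r, bit (v r) * relu (a t r) < 1 := by
        rcases bit_eq_one_or sp with hs | hs <;> rw [hs] <;> linarith [hact.1, hact.2]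
      have h2 : bit sp * cp ≤ β := by
        refine (le_abs_self _).trans ?_
        rwa [abs_mul, abs_bit, one_mul]
      linarith
    · linarith

/-- After sufficiently many steps the gate is saturated with the right sign. -/
theorem saturated (h : PatternDynamics v cp cm a) {β θ : ℝ} (hkβ : k * β ≤ 1 / 2) (hθ : 0 < θ)
    {sp sm : ℤˣ} (hp : θ ≤ bit sp * cp) (hm : cm = 0 ∨ θ ≤ bit sm * cm) (hcp : |cp| ≤ β)
    (hcm : |cm| ≤ β) (h₀ : ∀ l, |a 0 l| ≤ β) (hgp : ∃ l, v l = sp ∧ 0 < a 0 l)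
    (hgm : ∃ l, v l = sm ∧ a 0 l < 0) {T : ℕ} (hT : 4 < T * θ) :
    1 ≤ bit sp * ∑ r, bit (v r) * relu (a T r) := by
  obtain ⟨l, hl, hl₀⟩ := hgp
  obtain ⟨l', hl', hl₀'⟩ := hgm
  have hβ : 0 ≤ β := (abs_nonneg cp).trans hcp
  have hp' : 0 ≤ bit sp * cp := hθ.le.trans hp
  have hm' : 0 ≤ bit sm * cm := by
    rcases hm with hm | hm
    · rw [hm, mul_zero]
    · exact hθ.le.trans hm
  have h₀' : ∀ l, |(-a) 0 l| ≤ β := fun l => by simpa using h₀ l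
  have hpos' : 0 < (-a) 0 l' := by simpa using hl₀'
  by_contra! hlt
  -- Saturation with the wrong sign is impossible: the active good neuron keeps the signed output
  -- above -1/2.
  have hactT : deriv hardTanh (∑ r, bit (v r) * relu (a T r)) = 1 := by
    have h1 := h.good_sub_le hβ hp' hcm h₀ hl T
    have h2 := (h.good_pos_and_succ hp' hl hl₀ T).1
    rw [deriv_hardTanh, if_pos]
    rcases bit_eq_one_or sp with hs | hs <;> rw [hs] at h1 hlt <;> constructor <;> linarith
  -- If neither pattern acted at time `t`, the state would be frozen from then on and u would be
  -- inactive at time `T` too. Both patterns must be followed, because motion caused by -u may undo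
  -- the saturation of u.
  have hact : ∀ t ≤ T, deriv hardTanh (∑ r, bit (v r) * relu (a t r)) = 1 ∨
      (cm ≠ 0 ∧ deriv hardTanh (∑ r, bit (v r) * relu (-a t r)) = 1) := by
    intro t ht
    by_contra! hno
    have hD : ∀ z, deriv hardTanh z ≠ 1 → deriv hardTanh z = 0 := by
      intro z hz
      rw [deriv_hardTanh] at hz ⊢
      split_ifs at hz ⊢ <;> simp_all
    have hfix : ∀ s, a (t + s) = a t := by
      intro s
      induction s with
      | zero => rfl
      | succ s ih =>
        funext r
        rw [← add_assoc, h (t + s) r, ih, hD _ hno.1]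
        by_cases hc : cm = 0
        · rw [hc]
          ring
        · rw [hD _ (hno.2 hc)]
          ring
    have := hfix (T - t)
    rw [Nat.add_sub_cancel' ht] at this
    rw [this] at hactT
    exact hno.1 hactT
  -- The potential is the sum of a good neuron for u and one for -u: neither decreases, and at each
  -- step at least one gains `θ`. Both stay at most 2, which contradicts `4 < T * θ`.
  have hgrow : ∀ t ≤ T, t * θ ≤ a t l + (-a) t l' := by
    intro t
    induction t with
    | zero =>
      intro _
      simp only [Nat.cast_zero, zero_mul]
      exact (add_pos hl₀ hpos').le
    | succ t ih =>
      intro ht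
      have ih' := ih (Nat.le_of_succ_le ht)
      have e1 := (h.good_pos_and_succ hp' hl hl₀ t).2
      have e2 := (h.neg.good_pos_and_succ hm' hl' hpos' t).2
      have n1 := mul_nonneg hp' (deriv_hardTanh_nonneg (∑ r, bit (v r) * relu (a t r)))
      have n2 := mul_nonneg hm' (deriv_hardTanh_nonneg (∑ r, bit (v r) * relu ((-a) t r)))
      rw [e1, e2]
      push_cast
      rcases hact t (Nat.le_of_succ_le ht) with h1 | ⟨hc, h1⟩
      · rw [h1] at n1 ⊢
        linarith
      · have h1' : deriv hardTanh (∑ r, bit (v r) * relu ((-a) t r)) = 1 := h1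
        rw [h1'] at n2 ⊢
        have := hm.resolve_left hc
        linarith
  have b1 := h.good_le_two hkβ hp' hcp hcm h₀ hl hl₀ T
  have b2 := h.neg.good_le_two hkβ hm' hcm hcp h₀' hl' hpos' T
  linarith [hgrow T le_rfl]

end PatternDynamics

/-! ### Training one layer on exact inputs -/

/-- The two input bits of the `j`-th gate of layer `i`. -/
def pattern {i : ℕ} (z : Fin (2 ^ (i + 1)) → ℤˣ) (j : Fin (2 ^ i)) : Fin 2 → ℤˣ :=
  fun q => z (child j q)

theorem inputPair_realInput {i : ℕ} (z : Fin (2 ^ (i + 1)) → ℤˣ) (j : Fin (2 ^ i)) :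
    inputPair (realInput z) j = realInput (pattern z j) := rfl

theorem dot_neg_realInput (w : Fin 2 → ℝ) (u : Fin 2 → ℤˣ) :
    dot w (realInput (-u)) = -dot w (realInput u) := by
  simp [dot, realInput, bit_neg, Finset.sum_neg_distrib]

/-- Distinct non-opposite sign patterns in the plane are orthogonal; this decouples the pairs {u,
-u}. -/
theorem sum_bit_mul_bit (p u : Fin 2 → ℤˣ) :
    ∑ q, bit (p q) * bit (u q) = 2 * (if p = u then 1 else 0) - 2 * (if p = -u then 1 else 0) := by
  have h : ∀ p u : Fin 2 → ℤˣ, ∑ q, (p q : ℤ) * (u q : ℤ) =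
      2 * (if p = u then 1 else 0) - 2 * (if p = -u then 1 else 0) := by decide
  have h' := congrArg (fun x : ℤ => (x : ℝ)) (h p u)
  simp only [bit]
  push_cast at h'
  exact h'

theorem abs_avgPool_lt_one {n : ℕ} {x : Fin n → ℝ} (hx : ∀ j, |x j| ≤ 1) {j₀ : Fin n}
    (h₀ : |x j₀| < 1) : |avgPool x| < 1 := by
  have hn : (0 : ℝ) < n := by exact_mod_cast j₀.pos
  rw [avgPool, abs_mul, abs_of_pos (one_div_pos.2 hn), one_div, inv_mul_lt_iff₀ hn, mul_one]
  calc |∑ j, x j| ≤ ∑ j, |x j| := Finset.abs_sum_le_sum_abs _ _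
    _ < ∑ _j : Fin n, (1 : ℝ) :=
      Finset.sum_lt_sum (fun j _ => hx j) ⟨j₀, Finset.mem_univ _, h₀⟩
    _ = n := by simp

/-- If gate `j` is saturated, both sides vanish. Otherwise its output is strictly inside (-1,1) and
so is the average, where hinge and regularizer are both linear. Thus the other gates do not
influence the gradient at `j`. -/
theorem deriv_loss_of_unsaturated {i k : ℕ} (lam : ℝ) (y : ℤˣ) (W : LayerW i k) (V : LayerV i k)
    (x : Fin (2 ^ (i + 1)) → ℝ) (j : Fin (2 ^ i)) (c : ℝ) :
    (deriv (hinge (bit y)) (avgPool (block W V x)) + deriv (reg lam) (avgPool (block W V x))) *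
        (c * (deriv hardTanh (preAct (W j) (V j) (inputPair x j)))) =
      -(bit y + lam) * (c * (deriv hardTanh (preAct (W j) (V j) (inputPair x j)))) := by
  rw [deriv_hardTanh]
  split_ifs with h
  · have hlt : |avgPool (block W V x)| < 1 := by
      refine abs_avgPool_lt_one (j₀ := j)
        (fun r => abs_le.2 ⟨neg_one_le_hardTanh _, hardTanh_le_one _⟩) ?_
      rw [block, neuralGate, hardTanh_of_mem h.1.le h.2.le]
      exact abs_lt.2 h
    obtain ⟨h1, h2⟩ := abs_lt.1 hlt
    rw [deriv_hinge, deriv_reg, if_pos h2, if_pos]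
    · ring
    · rcases bit_eq_one_or y with hy | hy <;> rw [hy] <;> linarith
  · simp

/-- The empirical correlation of the regularized label with a pattern of the bits `Z` below a
gate. -/
def patternCorr {n m i : ℕ} (lam : ℝ) (S : Fin m → (Fin n → ℤˣ) × ℤˣ)
    (Z : (Fin n → ℤˣ) → Fin (2 ^ (i + 1)) → ℤˣ) (j : Fin (2 ^ i)) (u : Fin 2 → ℤˣ) : ℝ :=
  (1 / (m : ℝ)) * ∑ e, (bit (S e).2 + lam) * if pattern (Z (S e).1) j = u then 1 else 0

theorem abs_patternCorr_le {n m i : ℕ} (lam : ℝ) (S : Fin m → (Fin n → ℤˣ) × ℤˣ)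
    (Z : (Fin n → ℤˣ) → Fin (2 ^ (i + 1)) → ℤˣ) (j : Fin (2 ^ i)) (u : Fin 2 → ℤˣ) :
    |patternCorr lam S Z j u| ≤ 1 + |lam| := by
  rw [patternCorr, abs_mul, abs_of_nonneg (by positivity)]
  have h : |∑ e, (bit (S e).2 + lam) * if pattern (Z (S e).1) j = u then 1 else 0| ≤
      ∑ _e : Fin m, (1 + |lam|) := by
    refine (Finset.abs_sum_le_sum_abs _ _).trans (Finset.sum_le_sum fun e _ => ?_)
    have := (abs_add_le (bit (S e).2) lam)
    rw [abs_bit] at this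
    split_ifs
    · simpa using this
    · simp only [mul_zero, abs_zero]
      positivity
  rw [Finset.sum_const, Finset.card_univ, Fintype.card_fin, nsmul_eq_mul] at h
  rcases Nat.eq_zero_or_pos m with rfl | hm
  · simp only [CharP.cast_eq_zero, div_zero, zero_mul]
    positivity
  · have hm' : (0 : ℝ) < m := by exact_mod_cast hm
    rwa [one_div, inv_mul_le_iff₀ hm']

section

variable {n m i k : ℕ} (lam : ℝ) (S : Fin m → (Fin n → ℤˣ) × ℤˣ)
  {N : (Fin n → ℝ) → (Fin (2 ^ (i + 1)) → ℝ)} {Z : (Fin n → ℤˣ) → Fin (2 ^ (i + 1)) → ℤˣ}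

/-- Projecting on u leaves only the examples with pattern u or -u. The factor 2 is the squared norm
of u, and 1/2^i comes from pooling. -/
theorem dot_lossGrad (hN : ∀ x, N (realInput x) = realInput (Z x)) (V : LayerV i k)
    (W : LayerW i k) (j : Fin (2 ^ i)) (l : Fin k) (u : Fin 2 → ℤˣ) :
    dot (lossGrad lam S N V W j l) (realInput u) =
      -(2 / 2 ^ i * (V j l *
        (patternCorr lam S Z j u * (deriv hardTanh (preAct (W j) (V j) (realInput u)) *
          deriv relu (dot (W j l) (realInput u))) -
        patternCorr lam S Z j (-u) * (deriv hardTanh (preAct (W j) (V j) (realInput (-u))) *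
          deriv relu (dot (W j l) (realInput (-u))))))) := by
  have hterm : ∀ (e : Fin m) (q : Fin 2), (let x := N (realInput (S e).1)
       let yhat := avgPool (block W V x)
       (deriv (hinge (bit (S e).2)) yhat + deriv (reg lam) yhat) *
        ((1 / ((2 ^ i : ℕ) : ℝ)) *
          (deriv hardTanh (preAct (W j) (V j) (inputPair x j)) *
            (V j l * (deriv relu (dot (W j l) (inputPair x j)) * inputPair x j q))))) =
      -(1 / 2 ^ i) * V j l * ((bit (S e).2 + lam) *
        (deriv hardTanh (preAct (W j) (V j) (realInput (pattern (Z (S e).1) j))) *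
        deriv relu (dot (W j l) (realInput (pattern (Z (S e).1) j))))) *
        bit (pattern (Z (S e).1) j q) := by
    intro e q
    -- All remaining factors of the back-propagated product are absorbed into the free constant.
    have h := deriv_loss_of_unsaturated lam (S e).2 W V (N (realInput (S e).1)) j
      ((1 / ((2 ^ i : ℕ) : ℝ)) * (V j l *
        (deriv relu (dot (W j l) (inputPair (N (realInput (S e).1)) j)) *
        inputPair (N (realInput (S e).1)) j q)))
    dsimp only
    refine Eq.trans ?_ (h.trans ?_)
    · ring
    · rw [hN, inputPair_realInput]
      push_cast
      simp only [realInput]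
      ring
  have hsum : dot (lossGrad lam S N V W j l) (realInput u) = (1 / (m : ℝ)) * ∑ e,
      -(1 / 2 ^ i) * V j l * ((bit (S e).2 + lam) *
        (deriv hardTanh (preAct (W j) (V j) (realInput (pattern (Z (S e).1) j))) *
        deriv relu (dot (W j l) (realInput (pattern (Z (S e).1) j))))) *
        ∑ q, bit (pattern (Z (S e).1) j q) * bit (u q) := by
    simp only [dot, lossGrad] at hterm ⊢
    simp only [hterm, Finset.mul_sum, Finset.sum_mul]
    rw [Finset.sum_comm]
    refine Finset.sum_congr rfl fun e _ => Finset.sum_congr rfl fun q _ => ?_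
    simp only [realInput]
    ring
  rw [hsum]
  simp only [patternCorr]
  have hsplit : ∀ e : Fin m, -(1 / 2 ^ i) * V j l * ((bit (S e).2 + lam) *
        (deriv hardTanh (preAct (W j) (V j) (realInput (pattern (Z (S e).1) j))) *
        deriv relu (dot (W j l) (realInput (pattern (Z (S e).1) j))))) *
        ∑ q, bit (pattern (Z (S e).1) j q) * bit (u q) =
      -(2 / 2 ^ i * V j l * (deriv hardTanh (preAct (W j) (V j) (realInput u)) *
          deriv relu (dot (W j l) (realInput u)))) *
        ((bit (S e).2 + lam) * if pattern (Z (S e).1) j = u then 1 else 0) +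
      (2 / 2 ^ i * V j l * (deriv hardTanh (preAct (W j) (V j) (realInput (-u))) *
          deriv relu (dot (W j l) (realInput (-u))))) *
        ((bit (S e).2 + lam) * if pattern (Z (S e).1) j = -u then 1 else 0) := by
    intro e
    rw [sum_bit_mul_bit]
    have hne : u ≠ -u := fun h => by
      have := congrFun h 0
      rcases Int.units_eq_one_or (u 0) with h' | h' <;> simp [h'] at this
    by_cases h1 : pattern (Z (S e).1) j = u
    · rw [h1, if_pos rfl, if_neg hne]
      ring
    · by_cases h2 : pattern (Z (S e).1) j = -u
      · rw [h2, if_neg (Ne.symm hne), if_pos rfl]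
        ring
      · rw [if_neg h1, if_neg h2]
        ring
  rw [Finset.sum_congr rfl fun e _ => hsplit e, Finset.sum_add_distrib, ← Finset.mul_sum,
    ← Finset.mul_sum]
  ring

theorem patternDynamics_trainLayer (hN : ∀ x, N (realInput x) = realInput (Z x)) (η : ℝ)
    (v : Fin (2 ^ i) → Fin k → ℤˣ) (W₀ : LayerW i k) (j : Fin (2 ^ i)) (u : Fin 2 → ℤˣ) :
    PatternDynamics (v j) (2 * η / 2 ^ i * patternCorr lam S Z j u)
      (2 * η / 2 ^ i * patternCorr lam S Z j (-u))
      (fun t l => dot (trainLayer lam η t S N (fun j l => bit (v j l)) W₀ j l) (realInput u)) := by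
  intro t l
  have hsucc : trainLayer lam η (t + 1) S N (fun j l => bit (v j l)) W₀ =
      trainLayer lam η t S N (fun j l => bit (v j l)) W₀ - η • lossGrad lam S N
        (fun j l => bit (v j l)) (trainLayer lam η t S N (fun j l => bit (v j l)) W₀) :=
    Function.iterate_succ_apply' _ _ _
  beta_reduce
  rw [hsucc]
  generalize trainLayer lam η t S N (fun j l => bit (v j l)) W₀ = W
  have hsub : dot ((W - η • lossGrad lam S N (fun j l => bit (v j l)) W) j l) (realInput u) =
      dot (W j l) (realInput u) -
        η * dot (lossGrad lam S N (fun j l => bit (v j l)) W j l) (realInput u) := by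
    simp only [dot, Pi.sub_apply, Pi.smul_apply, smul_eq_mul, sub_mul, Finset.sum_sub_distrib,
      Finset.mul_sum, mul_assoc]
  rw [hsub, dot_lossGrad lam S hN, deriv_relu, deriv_relu]
  simp only [preAct, dot_neg_realInput, neg_pos]
  ring

/-- If all patterns that occur are sufficiently correlated with their targets, then the trained
layer computes the targets. -/
theorem block_trainLayer (hN : ∀ x, N (realInput x) = realInput (Z x)) {η β B c : ℝ}
    {v : Fin (2 ^ i) → Fin k → ℤˣ} {W₀ : LayerW i k}
    {τ : Fin (2 ^ i) → (Fin 2 → ℤˣ) → ℤˣ} (hη : 0 < η) (hc : 0 < c) (hkβ : k * β ≤ 1 / 2)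
    (hcorr : ∀ j u, (∀ x, pattern (Z x) j ≠ u) ∨ c ≤ bit (τ j u) * patternCorr lam S Z j u)
    (hB : 1 + |lam| ≤ B) (hstep : 2 * η / 2 ^ i * B ≤ β)
    (hinit : ∀ j l u, |dot (W₀ j l) (realInput u)| ≤ β)
    (hgood : ∀ j u, ∃ l, v j l = τ j u ∧ 0 < dot (W₀ j l) (realInput u))
    {T : ℕ} (hT : 4 < T * (2 * η / 2 ^ i * c)) (x : Fin n → ℤˣ) :
    block (trainLayer lam η T S N (fun j l => bit (v j l)) W₀) (fun j l => bit (v j l))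
      (N (realInput x)) = realInput fun j => τ j (pattern (Z x) j) := by
  funext j
  rw [hN, block, neuralGate, inputPair_realInput]
  set u := pattern (Z x) j with hu
  have hη' : 0 < 2 * η / 2 ^ i := by positivity
  have hspeed : ∀ u, |2 * η / 2 ^ i * patternCorr lam S Z j u| ≤ β := fun u => by
    rw [abs_mul, abs_of_pos hη']
    exact (mul_le_mul_of_nonneg_left ((abs_patternCorr_le lam S Z j u).trans hB) hη'.le).trans hstep
  have hcorr' : ∀ u, c ≤ bit (τ j u) * patternCorr lam S Z j u → 2 * η / 2 ^ i * c ≤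
      bit (τ j u) * (2 * η / 2 ^ i * patternCorr lam S Z j u) := fun u h => by
    rw [mul_left_comm]
    exact mul_le_mul_of_nonneg_left h hη'.le
  -- A pattern that never occurs exerts no force; this is the case `cm = 0` of `saturated`.
  have hzero : ∀ u, (∀ x, pattern (Z x) j ≠ u) → patternCorr lam S Z j u = 0 := fun u h => by
    simp [patternCorr, h]
  have hsat := (patternDynamics_trainLayer lam S hN η v W₀ j u).saturated hkβ (mul_pos hη' hc)
    (sp := τ j u) (sm := τ j (-u))
    (hcorr' u ((hcorr j u).resolve_left fun h => h x rfl))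
    ((hcorr j (-u)).imp (fun h => by rw [hzero _ h, mul_zero]) (hcorr' (-u)))
    (hspeed u) (hspeed (-u)) (fun l => hinit j l u) (hgood j u)
    (by
      obtain ⟨l, h1, h2⟩ := hgood j (-u)
      refine ⟨l, h1, ?_⟩
      rw [dot_neg_realInput] at h2
      exact neg_pos.1 h2) hT
  change hardTanh (∑ l, _) = bit (τ j u)
  rcases bit_eq_one_or (τ j u) with h | h <;> rw [h] at hsat ⊢
  · exact hardTanh_of_ge (by linarith)
  · exact hardTanh_of_le (by linarith)

end

/-! ### The bits that the trained layers compute -/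

theorem parity_union {n : ℕ} {A B : Finset (Fin n)} (h : Disjoint A B) (x : Fin n → ℤˣ) :
    parity (A ∪ B) x = parity A x * parity B x := Finset.prod_union h

theorem parity_inter {n : ℕ} {A I : Finset (Fin n)} (h : A ⊆ I ∨ Disjoint A I) (x : Fin n → ℤˣ) :
    parity (I ∩ A) x = if A ⊆ I then parity A x else 1 := by
  split_ifs with hA
  · rw [Finset.inter_eq_right.2 hA]
  · rw [Finset.inter_comm, Finset.disjoint_iff_inter_eq_empty.1 (h.resolve_left hA)]
    rfl

theorem parity_inter_union {n : ℕ} {A B I : Finset (Fin n)} (hA : A ⊆ I ∨ Disjoint A I)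
    (hB : B ⊆ I ∨ Disjoint B I) (h : Disjoint A B) (x : Fin n → ℤˣ) :
    parity (I ∩ (A ∪ B)) x =
      (if A ⊆ I then parity A x else 1) * (if B ⊆ I then parity B x else 1) := by
  rw [Finset.inter_union_distrib_left, parity_union, parity_inter hA, parity_inter hB]
  exact h.mono Finset.inter_subset_right Finset.inter_subset_right

section

variable {d : ℕ}

/-- The input bits that belong to the `j`-th node of level `i`: for an input node the bit itself,
for a gate the bits of `I` below it. -/
def leafSet (I : Finset (Fin (2 ^ d))) (i : ℕ) (j : Fin (2 ^ i)) : Finset (Fin (2 ^ d)) :=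
  if i = d then Finset.univ.filter fun a => a.val = j.val
  else I.filter fun a => a.val / 2 ^ (d - i) = j.val

theorem leafSet_subset (I : Finset (Fin (2 ^ d))) {i : ℕ} (hi : i ≠ d) (j : Fin (2 ^ i)) :
    leafSet I i j ⊆ I := by
  rw [leafSet, if_neg hi]
  exact Finset.filter_subset _ _

theorem leafSet_depth (I : Finset (Fin (2 ^ d))) (j : Fin (2 ^ d)) : leafSet I d j = {j} := by
  ext a
  simp [leafSet, Fin.ext_iff]

theorem leafSet_subset_or_disjoint (I : Finset (Fin (2 ^ d))) (i : ℕ) (j : Fin (2 ^ i)) :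
    leafSet I i j ⊆ I ∨ Disjoint (leafSet I i j) I := by
  by_cases hi : i = d
  · subst hi
    rw [leafSet_depth, Finset.singleton_subset_iff, Finset.disjoint_singleton_left]
    exact em _
  · exact Or.inl (leafSet_subset I hi j)

theorem mem_leafSet {I : Finset (Fin (2 ^ d))} {i : ℕ} (hi : i ≤ d) {j : Fin (2 ^ i)}
    {a : Fin (2 ^ d)} : a ∈ leafSet I i j ↔ (i ≠ d → a ∈ I) ∧ a.val / 2 ^ (d - i) = j.val := by
  by_cases h : i = d
  · subst h
    simp [leafSet]
  · simp [leafSet, h]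

theorem disjoint_leafSet (I : Finset (Fin (2 ^ d))) {i : ℕ} (hi : i ≤ d) {j j' : Fin (2 ^ i)}
    (hj : j ≠ j') : Disjoint (leafSet I i j) (leafSet I i j') := by
  rw [Finset.disjoint_left]
  intro a h h'
  rw [mem_leafSet hi] at h h'
  exact hj (Fin.ext (h.2.symm.trans h'.2))

theorem child_zero_ne_child_one {i : ℕ} (j : Fin (2 ^ i)) : child j 0 ≠ child j 1 := by
  simp [child]

/-- Dividing a leaf index by 2^(d-i) gives its ancestor at level i. The intersection with `I`
matters only when the children are leaves. -/
theorem leafSet_eq (I : Finset (Fin (2 ^ d))) {i : ℕ} (hi : i < d) (j : Fin (2 ^ i)) :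
    leafSet I i j = I ∩ (leafSet I (i + 1) (child j 0) ∪ leafSet I (i + 1) (child j 1)) := by
  ext a
  rw [Finset.mem_inter, Finset.mem_union, mem_leafSet hi.le, mem_leafSet hi, mem_leafSet hi]
  have h : a.val / 2 ^ (d - i) = a.val / 2 ^ (d - (i + 1)) / 2 := by
    rw [Nat.div_div_eq_div_mul, ← pow_succ]
    congr 2
    omega
  have h0 : (child j 0).val = 2 * j.val := rfl
  have h1 : (child j 1).val = 2 * j.val + 1 := rfl
  rw [h, h0, h1]
  have h2 : a.val / 2 ^ (d - (i + 1)) / 2 = j.val ↔ a.val / 2 ^ (d - (i + 1)) = 2 * j.val ∨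
      a.val / 2 ^ (d - (i + 1)) = 2 * j.val + 1 := by omega
  rw [h2]
  have := hi.ne
  tauto

theorem leafSet_zero (I : Finset (Fin (2 ^ d))) (hd : 1 ≤ d) (j : Fin (2 ^ 0)) :
    leafSet I 0 j = I := by
  ext a
  rw [mem_leafSet (Nat.zero_le d)]
  have h1 : a.val / 2 ^ (d - 0) = 0 := Nat.div_eq_of_lt a.isLt
  have h2 : j.val = 0 := Nat.lt_one_iff.1 j.isLt
  have h3 : 0 ≠ d := by omega
  rw [h1, h2]
  simp [h3]

theorem parity_leafSet (I : Finset (Fin (2 ^ d))) {i : ℕ} (hi : i < d) (j : Fin (2 ^ i))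
    (x : Fin (2 ^ d) → ℤˣ) : parity (leafSet I i j) x =
      (if leafSet I (i + 1) (child j 0) ⊆ I then parity (leafSet I (i + 1) (child j 0)) x else 1) *
      (if leafSet I (i + 1) (child j 1) ⊆ I then parity (leafSet I (i + 1) (child j 1)) x else 1)
    := by
  rw [leafSet_eq I hi, parity_inter_union (leafSet_subset_or_disjoint I _ _)
    (leafSet_subset_or_disjoint I _ _) (disjoint_leafSet I hi (child_zero_ne_child_one j))]

theorem parityCircuit_gate (I : Finset (Fin (2 ^ d))) {i : ℕ} (hi : i < d) (j : Fin (2 ^ i))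
    (x : Fin (2 ^ d) → ℤˣ) : parityCircuit I ⟨i, hi⟩ j (parity (leafSet I (i + 1) (child j 0)) x)
      (parity (leafSet I (i + 1) (child j 1)) x) = parity (leafSet I i j) x := by
  rw [parity_leafSet I hi, parityCircuit]
  dsimp only
  by_cases h : i + 1 = d
  · rw [if_pos h]
    subst h
    have hq : ∀ q : Fin 2, leafSet I (i + 1) (child j q) ⊆ I ↔
        ∃ a ∈ I, a.val = 2 * j.val + q.val := by
      intro q
      rw [leafSet_depth, Finset.singleton_subset_iff]
      constructor
      · exact fun h => ⟨_, h, rfl⟩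
      · rintro ⟨a, ha, h⟩
        rwa [show child j q = a from Fin.ext h.symm]
    simp only [hq, Fin.val_zero, Fin.val_one, add_zero]
  · rw [if_neg h, if_pos (leafSet_subset I h _), if_pos (leafSet_subset I h _)]

theorem parityCircuit_evalFrom (I : Finset (Fin (2 ^ d))) (hd : 1 ≤ d) (x : Fin (2 ^ d) → ℤˣ)
    (i : ℕ) (hi : i ≤ d) :
    (parityCircuit I).evalFrom i hi (fun j => parity (leafSet I i j) x) = parity I x := by
  induction i with
  | zero => rw [TreeCircuit.evalFrom, leafSet_zero I hd]
  | succ i ih =>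
    rw [TreeCircuit.evalFrom]
    simp only [parityCircuit_gate I hi]
    exact ih _

theorem parityCircuit_eval (I : Finset (Fin (2 ^ d))) (hd : 1 ≤ d) (x : Fin (2 ^ d) → ℤˣ) :
    (parityCircuit I).eval x = parity I x := by
  rw [← parityCircuit_evalFrom I hd x d le_rfl, TreeCircuit.eval]
  congr 1
  funext j
  simp [leafSet_depth, parity]

/-- The sign of a real number, with the value `1` at zero. -/
def signBit (r : ℝ) : ℤˣ := if 0 ≤ r then 1 else -1

theorem bit_signBit_mul_self (r : ℝ) : bit (signBit r) * r = |r| := by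
  rw [signBit]
  split_ifs with h
  · rw [bit_one, one_mul, abs_of_nonneg h]
  · rw [bit_neg_one, abs_of_neg (not_le.1 h), neg_one_mul]

/-- The mean of the parity on `A`. -/
def parityMean {n : ℕ} (p : Fin n → ℝ) (A : Finset (Fin n)) : ℝ := ∏ a ∈ A, (2 * p a - 1)

/-- The sign with which a node computes its parity: gates learn to have a nonnegative mean. -/
def nodeSign (p : Fin (2 ^ d) → ℝ) (I : Finset (Fin (2 ^ d))) (i : ℕ) (j : Fin (2 ^ i)) : ℤˣ :=
  if i = d then 1 else signBit (parityMean p (leafSet I i j))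

/-- The bits of level `i` of the trained network. -/
def nodeBit (p : Fin (2 ^ d) → ℝ) (I : Finset (Fin (2 ^ d))) (i : ℕ) (x : Fin (2 ^ d) → ℤˣ)
    (j : Fin (2 ^ i)) : ℤˣ :=
  nodeSign p I i j * parity (leafSet I i j) x

/-- The Boolean gate that the `j`-th gate of layer `i` learns. -/
def nodeTarget (p : Fin (2 ^ d) → ℝ) (I : Finset (Fin (2 ^ d))) (i : ℕ) (j : Fin (2 ^ i))
    (u : Fin 2 → ℤˣ) : ℤˣ :=
  nodeSign p I i j *
    ((if leafSet I (i + 1) (child j 0) ⊆ I then nodeSign p I (i + 1) (child j 0) * u 0 else 1) *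
    (if leafSet I (i + 1) (child j 1) ⊆ I then nodeSign p I (i + 1) (child j 1) * u 1 else 1))

theorem nodeBit_depth (p : Fin (2 ^ d) → ℝ) (I : Finset (Fin (2 ^ d))) (x : Fin (2 ^ d) → ℤˣ) :
    nodeBit p I d x = x := by
  funext j
  simp [nodeBit, nodeSign, leafSet_depth, parity]

/-- The target multiplies by the children's signs again, and these square to 1. -/
theorem nodeTarget_pattern (p : Fin (2 ^ d) → ℝ) (I : Finset (Fin (2 ^ d))) {i : ℕ} (hi : i < d)
    (j : Fin (2 ^ i)) (x : Fin (2 ^ d) → ℤˣ) :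
    nodeTarget p I i j (pattern (nodeBit p I (i + 1) x) j) = nodeBit p I i x j := by
  rw [nodeBit, nodeTarget, parity_leafSet I hi]
  simp only [pattern, nodeBit, ← mul_assoc, Int.units_mul_self, one_mul]

/-- Layerwise training on a good sample with a good initialization returns the bit of the output
node. -/
theorem trainFrom_eq {m k T : ℕ} {p : Fin (2 ^ d) → ℝ} {I : Finset (Fin (2 ^ d))} {lam η β B c : ℝ}
    {S : Fin m → (Fin (2 ^ d) → ℤˣ) × ℤˣ} {ω : Init d k} (hη : 0 < η) (hc : 0 < c)
    (hkβ : k * β ≤ 1 / 2)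
    (hcorr : ∀ i < d, ∀ (j : Fin (2 ^ i)) u, (∀ x, pattern (nodeBit p I (i + 1) x) j ≠ u) ∨
      c ≤ bit (nodeTarget p I i j u) * patternCorr lam S (nodeBit p I (i + 1)) j u)
    (hB : 1 + |lam| ≤ B) (hB' : 0 ≤ B) (hstep : 2 * η * B ≤ β)
    (hinit : ∀ i j l u, |dot (ω i j l).1 (realInput u)| ≤ β)
    (hgood : ∀ (i : Fin d) j u, ∃ l, (ω i j l).2 = nodeTarget p I i j u ∧
      0 < dot (ω i j l).1 (realInput u))
    (hT : 4 < T * (4 * η / 2 ^ d * c)) (i : ℕ) (hi : i ≤ d)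
    (N : (Fin (2 ^ d) → ℝ) → (Fin (2 ^ i) → ℝ))
    (hN : ∀ x, N (realInput x) = realInput (nodeBit p I i x)) (x : Fin (2 ^ d) → ℤˣ) :
    trainFrom lam η T S ω i hi N (realInput x) = bit (nodeBit p I 0 x 0) := by
  induction i with
  | zero =>
    exact congrFun (hN x) 0
  | succ i ih =>
    rw [trainFrom]
    refine ih _ _ fun x => ?_
    have h1 : (1 : ℝ) ≤ 2 ^ i := one_le_pow₀ one_le_two
    have h2 : (2 : ℝ) ^ (i + 1) ≤ 2 ^ d := pow_le_pow_right₀ one_le_two hi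
    refine (block_trainLayer (v := fun j l => (ω ⟨i, hi⟩ j l).2) (β := β) (B := B) (c := c)
      (τ := nodeTarget p I i) lam S hN hη hc hkβ (hcorr i hi) hB ?_
      (hinit ⟨i, hi⟩) (hgood ⟨i, hi⟩) ?_ x).trans ?_
    · refine le_trans ?_ hstep
      gcongr
      exact div_le_self (by positivity) h1
    · refine hT.trans_le ?_
      -- The slowest layer is the widest one, with 2^(d-1) gates.
      have : 4 * η / 2 ^ d ≤ 2 * η / 2 ^ i := by
        rw [div_le_div_iff₀ (by positivity) (by positivity)]
        have := mul_le_mul_of_nonneg_left h2 (by positivity : 0 ≤ 2 * η)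
        rw [pow_succ] at this
        linarith
      gcongr
    · simp only [nodeTarget_pattern p I hi]

end

/-! ### Population correlations -/

/-- Makes the finite spaces of inputs and examples discrete, so measurability there is automatic. -/
instance : MeasurableSingletonClass ℤˣ :=
  ⟨fun u => ⟨{(u : ℤ)}, MeasurableSet.singleton _, by ext x; simp [Units.ext_iff]⟩⟩

theorem isProbabilityMeasure_bitLaw {p : ℝ} (h₀ : 0 ≤ p) (h₁ : p ≤ 1) :
    IsProbabilityMeasure (bitLaw p) := by
  constructor
  simp only [bitLaw, Measure.add_apply, Measure.smul_apply, measure_univ, smul_eq_mul, mul_one]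
  rw [← ENNReal.ofReal_add h₀ (by linarith), add_sub_cancel, ENNReal.ofReal_one]

theorem integral_bitLaw {p : ℝ} (h₀ : 0 ≤ p) (h₁ : p ≤ 1) (f : ℤˣ → ℝ) :
    ∫ b, f b ∂bitLaw p = p * f 1 + (1 - p) * f (-1) := by
  rw [bitLaw, integral_add_measure, integral_smul_measure, integral_smul_measure, integral_dirac,
    integral_dirac, ENNReal.toReal_ofReal h₀, ENNReal.toReal_ofReal (by linarith)]
  · rfl
  · exact (Integrable.of_finite).smul_measure ENNReal.ofReal_ne_top
  · exact (Integrable.of_finite).smul_measure ENNReal.ofReal_ne_top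

theorem bit_prod {ι : Type*} (A : Finset ι) (f : ι → ℤˣ) : bit (∏ a ∈ A, f a) = ∏ a ∈ A, bit (f a) :=
  map_prod ((Int.castRingHom ℝ : ℤ →* ℝ).comp (Units.coeHom ℤ)) f A

section

variable {n : ℕ} {p : Fin n → ℝ}

theorem isProbabilityMeasure_productLaw (hp : ∀ j, 0 ≤ p j ∧ p j ≤ 1) :
    IsProbabilityMeasure (productLaw p) := by
  have := fun j => isProbabilityMeasure_bitLaw (hp j).1 (hp j).2
  rw [productLaw]
  infer_instance

theorem integral_parity (hp : ∀ j, 0 ≤ p j ∧ p j ≤ 1) (A : Finset (Fin n)) :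
    ∫ x, bit (parity A x) ∂productLaw p = parityMean p A := by
  have := fun j => isProbabilityMeasure_bitLaw (hp j).1 (hp j).2
  have h : ∀ x : Fin n → ℤˣ, bit (parity A x) = ∏ j, if j ∈ A then bit (x j) else 1 := fun x => by
    rw [parity, bit_prod, Finset.prod_ite_mem, Finset.univ_inter]
  simp only [h]
  rw [productLaw, integral_fintype_prod_eq_prod (fun j b => if j ∈ A then bit b else 1), parityMean,
    ← Finset.univ_inter A, ← Finset.prod_ite_mem, Finset.univ_inter]
  refine Finset.prod_congr rfl fun j _ => ?_
  rw [integral_bitLaw (hp j).1 (hp j).2]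
  split_ifs
  · rw [bit_one, bit_neg_one]
    ring
  · ring

theorem parityMean_union {A B : Finset (Fin n)} (h : Disjoint A B) :
    parityMean p (A ∪ B) = parityMean p A * parityMean p B := Finset.prod_union h

/-- Expectations of products of affine functions of disjoint parities. -/
theorem integral_affine_parities (hp : ∀ j, 0 ≤ p j ∧ p j ≤ 1) {A B R : Finset (Fin n)}
    (hAB : Disjoint A B) (hAR : Disjoint A R) (hBR : Disjoint B R) (a b r c : ℝ) :
    ∫ x, (r * bit (parity R x) + c) * ((1 + a * bit (parity A x)) / 2 *
        ((1 + b * bit (parity B x)) / 2)) ∂productLaw p =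
      (r * parityMean p R + c) * ((1 + a * parityMean p A) / 2 *
        ((1 + b * parityMean p B) / 2)) := by
  have := isProbabilityMeasure_productLaw hp
  have hadd : ∀ f g : (Fin n → ℤˣ) → ℝ, ∫ x, (f x + g x) ∂productLaw p =
      ∫ x, f x ∂productLaw p + ∫ x, g x ∂productLaw p := fun f g =>
    integral_add Integrable.of_finite Integrable.of_finite
  have hmul : ∀ (c : ℝ) (X : Finset (Fin n)), ∫ x, c * bit (parity X x) ∂productLaw p =
      c * parityMean p X := fun c X => by rw [integral_const_mul, integral_parity hp]
  have hARB : Disjoint (A ∪ B) R := Finset.disjoint_union_left.2 ⟨hAR, hBR⟩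
  -- The product expands into eight parities over unions of the disjoint sets, whose means are
  -- multiplicative.
  have h : ∀ x : Fin n → ℤˣ, (r * bit (parity R x) + c) * ((1 + a * bit (parity A x)) / 2 *
        ((1 + b * bit (parity B x)) / 2)) =
      c / 4 * bit (parity ∅ x) + (r / 4 * bit (parity R x) + (c * a / 4 * bit (parity A x) +
      (c * b / 4 * bit (parity B x) + (c * a * b / 4 * bit (parity (A ∪ B) x) +
      (r * a / 4 * bit (parity (A ∪ R) x) + (r * b / 4 * bit (parity (B ∪ R) x) +
      r * a * b / 4 * bit (parity (A ∪ B ∪ R) x))))))) := fun x => by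
    rw [parity_union hARB, parity_union hAB, parity_union hAR, parity_union hBR]
    have h0 : parity ∅ x = 1 := rfl
    simp only [bit_mul, h0, bit_one]
    ring
  simp only [h]
  rw [hadd, hadd, hadd, hadd, hadd, hadd, hadd]
  simp only [hmul]
  rw [parityMean_union hARB, parityMean_union hAB, parityMean_union hAR, parityMean_union hBR,
    show parityMean p ∅ = 1 from rfl]
  ring

theorem isProbabilityMeasure_exampleLaw (hp : ∀ j, 0 ≤ p j ∧ p j ≤ 1) (I : Finset (Fin n))
    (s : ℤˣ) : IsProbabilityMeasure (exampleLaw p I s) := by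
  have := isProbabilityMeasure_productLaw hp
  exact Measure.isProbabilityMeasure_map Measurable.of_discrete.aemeasurable

theorem integral_exampleLaw (I : Finset (Fin n)) (s : ℤˣ) (f : (Fin n → ℤˣ) × ℤˣ → ℝ) :
    ∫ e, f e ∂exampleLaw p I s = ∫ x, f (x, s * parity I x) ∂productLaw p :=
  integral_map Measurable.of_discrete.aemeasurable Measurable.of_discrete.aestronglyMeasurable

theorem meanLabel_exampleLaw (hp : ∀ j, 0 ≤ p j ∧ p j ≤ 1) (I : Finset (Fin n)) (s : ℤˣ) :
    meanLabel (exampleLaw p I s) = bit s * parityMean p I := by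
  rw [meanLabel, integral_exampleLaw I s fun e => bit e.2]
  simp only [bit_mul]
  rw [integral_const_mul, integral_parity hp]

variable {ξ : ℝ}

theorem pow_le_abs_parityMean (hξ : 0 < ξ) (hp : ∀ j, 2 * ξ ≤ |2 * p j - 1|)
    (A : Finset (Fin n)) : (2 * ξ) ^ A.card ≤ |parityMean p A| := by
  rw [parityMean, Finset.abs_prod, ← Finset.prod_const]
  exact Finset.prod_le_prod (fun _ _ => by positivity) fun j _ => hp j

theorem abs_parityMean_le (hξ : 0 < ξ) (hp : ∀ j, |2 * p j - 1| ≤ 1 - 2 * ξ)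
    {A : Finset (Fin n)} (hA : A.Nonempty) : |parityMean p A| ≤ 1 - 2 * ξ := by
  obtain ⟨a, ha⟩ := hA
  rw [parityMean, Finset.abs_prod, ← Finset.mul_prod_erase A _ ha]
  refine (mul_le_of_le_one_right (abs_nonneg _) ?_).trans (hp a)
  exact Finset.prod_le_one (fun _ _ => abs_nonneg _) fun j _ => (hp j).trans (by linarith)

/-- A lower bound for the probability of a child's bit value that does occur. A constant bit (empty
`A`) has probability 1; otherwise a bias of at most 1 - 2ξ leaves at least ξ for each value. -/
theorem le_prob_bit (hξ : 0 < ξ) (hξ' : ξ < 1 / 4) (hp : ∀ j, |2 * p j - 1| ≤ 1 - 2 * ξ)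
    {A : Finset (Fin n)} {σ u : ℤˣ} {x : Fin n → ℤˣ} (hx : σ * parity A x = u) :
    ξ ≤ (1 + bit (u * σ) * parityMean p A) / 2 := by
  rcases A.eq_empty_or_nonempty with rfl | hA
  · have h : σ = u := by simpa [parity] using hx
    rw [h, Int.units_mul_self, bit_one, show parityMean p ∅ = 1 from rfl]
    linarith
  · have h := abs_parityMean_le hξ hp hA
    have h' : |bit (u * σ) * parityMean p A| ≤ 1 - 2 * ξ := by rwa [abs_mul, abs_bit, one_mul]
    linarith [(abs_le.1 h').1]

end

section

variable {d : ℕ} {p : Fin (2 ^ d) → ℝ} {ξ : ℝ}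

/-- An indicator of a bit is affine in the bit, which gives pattern indicators the form needed by
`integral_affine_parities`. -/
theorem ite_eq_bit (a b : ℤˣ) : (if a = b then (1 : ℝ) else 0) = (1 + bit (b * a)) / 2 := by
  rcases Int.units_eq_one_or a with rfl | rfl <;> rcases Int.units_eq_one_or b with rfl | rfl <;>
    simp [bit_one, bit_neg_one]

/-- Every pattern that occurs is correlated with the regularized label in the direction of the
target of the gate. -/
theorem le_integral_pattern (hξ : 0 < ξ) (hξ' : ξ < 1 / 4) (hp₀ : ∀ j, 0 ≤ p j ∧ p j ≤ 1)
    (hp : ∀ j, 2 * ξ ≤ |2 * p j - 1| ∧ |2 * p j - 1| ≤ 1 - 2 * ξ) {I : Finset (Fin (2 ^ d))}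
    (hI : I.card = d) {s : ℤˣ} (hs : 0 ≤ meanLabel (exampleLaw p I s)) {lam : ℝ}
    (hlam : lam = meanLabel (exampleLaw p I s) + (2 * ξ) ^ d / 4) {i : ℕ} (hi : i < d)
    (j : Fin (2 ^ i)) (u : Fin 2 → ℤˣ) :
    (∀ x, pattern (nodeBit p I (i + 1) x) j ≠ u) ∨
      3 / 4 * (ξ ^ 2 * (2 * ξ) ^ d) ≤ bit (nodeTarget p I i j u) *
        ∫ e, (bit e.2 + lam) * (if pattern (nodeBit p I (i + 1) e.1) j = u then 1 else 0)
          ∂exampleLaw p I s := by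
  by_contra! hcon
  obtain ⟨⟨x₀, hx₀⟩, hlt⟩ := hcon
  refine hlt.not_ge ?_
  set A := leafSet I (i + 1) (child j 0) with hA
  set B := leafSet I (i + 1) (child j 1) with hB
  set J := leafSet I i j with hJ
  set R := I \ (A ∪ B) with hR
  set t := nodeTarget p I i j u with ht
  have hAB : Disjoint A B := disjoint_leafSet I hi (child_zero_ne_child_one j)
  have hABR : Disjoint (A ∪ B) R := Finset.disjoint_sdiff
  obtain ⟨hAR, hBR⟩ := Finset.disjoint_union_left.1 hABR
  have hJeq : J = I ∩ (A ∪ B) := leafSet_eq I hi j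
  have hJR : Disjoint J R := hABR.mono_left (hJeq ▸ Finset.inter_subset_right)
  have hIJR : J ∪ R = I := by
    rw [hJeq, hR, Finset.union_comm]
    exact Finset.sdiff_union_inter I (A ∪ B)
  have hcard : J.card + R.card = d := by
    rw [← Finset.card_union_of_disjoint hJR, hIJR, hI]
  set σ := nodeSign p I i j with hσ
  have hσα : bit σ * parityMean p J = |parityMean p J| := by
    rw [hσ, nodeSign, if_neg hi.ne, bit_signBit_mul_self]
  have h2ξ : 0 < 2 * ξ := by linarith
  have h2ξ' : 2 * ξ ≤ 1 := by linarith
  -- the part of the label that is independent of the gate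
  set ρ := bit s * bit σ * parityMean p R with hρ
  have hmean : meanLabel (exampleLaw p I s) = ρ * |parityMean p J| := by
    rw [meanLabel_exampleLaw hp₀, ← hIJR, parityMean_union hJR, ← hσα, hρ]
    linear_combination (-bit s * parityMean p R * parityMean p J) * bit_mul_self σ
  have hαpos : 0 < |parityMean p J| :=
    (pow_pos h2ξ _).trans_le (pow_le_abs_parityMean hξ (fun j => (hp j).1) J)
  have hρ0 : 0 ≤ ρ := by
    rw [hmean] at hs
    exact nonneg_of_mul_nonneg_left hs hαpos
  have hρR : (2 * ξ) ^ R.card ≤ ρ := by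
    have h : |ρ| = |parityMean p R| := by
      rw [hρ, abs_mul, abs_mul, abs_bit, abs_bit, one_mul, one_mul]
    rw [← abs_of_nonneg hρ0, h]
    exact pow_le_abs_parityMean hξ (fun j => (hp j).1) R
  -- the expectation
  have hE : ∫ e, (bit e.2 + lam) * (if pattern (nodeBit p I (i + 1) e.1) j = u then 1 else 0)
      ∂exampleLaw p I s = (bit t * ρ + lam) *
        ((1 + bit (u 0 * nodeSign p I (i + 1) (child j 0)) * parityMean p A) / 2 *
        ((1 + bit (u 1 * nodeSign p I (i + 1) (child j 1)) * parityMean p B) / 2)) := by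
    rw [integral_exampleLaw I s fun e =>
      (bit e.2 + lam) * (if pattern (nodeBit p I (i + 1) e.1) j = u then 1 else 0)]
    have := integral_affine_parities hp₀ hAB hAR hBR
      (bit (u 0 * nodeSign p I (i + 1) (child j 0))) (bit (u 1 * nodeSign p I (i + 1) (child j 1)))
      (bit t * (bit s * bit σ)) lam
    rw [hρ, ← mul_assoc (bit t) (bit s * bit σ), ← this]
    refine integral_congr_ae (Filter.Eventually.of_forall fun x => ?_)
    beta_reduce
    have hite : (if pattern (nodeBit p I (i + 1) x) j = u then (1 : ℝ) else 0) =
        (if nodeBit p I (i + 1) x (child j 0) = u 0 then 1 else 0) *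
        (if nodeBit p I (i + 1) x (child j 1) = u 1 then 1 else 0) := by
      have : pattern (nodeBit p I (i + 1) x) j = u ↔ nodeBit p I (i + 1) x (child j 0) = u 0 ∧
          nodeBit p I (i + 1) x (child j 1) = u 1 := by
        rw [funext_iff, Fin.forall_fin_two]
        rfl
      simp only [this, ite_and, ite_mul, one_mul, zero_mul]
    have hfac : (1 + bit (u 0 * nodeSign p I (i + 1) (child j 0)) * bit (parity A x)) / 2 *
        ((1 + bit (u 1 * nodeSign p I (i + 1) (child j 1)) * bit (parity B x)) / 2) =
        if pattern (nodeBit p I (i + 1) x) j = u then 1 else 0 := by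
      rw [hite, ite_eq_bit, ite_eq_bit, nodeBit, nodeBit, ← hA, ← hB]
      simp only [bit_mul]
      ring
    rw [hfac]
    -- On the event that the pattern is u, the parity on `J` equals `σ * t`, so the label depends
    -- only on the parity on `R`.
    by_cases hu : pattern (nodeBit p I (i + 1) x) j = u
    · have h := nodeTarget_pattern p I hi j x
      rw [hu, ← ht, nodeBit] at h
      have hy : parity I x = parity J x * parity R x := by rw [← parity_union hJR, hIJR]
      rw [hy, h]
      simp only [bit_mul]
      linear_combination (-bit s * bit (parity J x) * bit (parity R x) *
        if pattern (nodeBit p I (i + 1) x) j = u then 1 else 0) * bit_mul_self σ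
    · rw [if_neg hu, mul_zero, mul_zero]
  have hu0 : nodeSign p I (i + 1) (child j 0) * parity A x₀ = u 0 := congrFun hx₀ 0
  have hu1 : nodeSign p I (i + 1) (child j 1) * parity B x₀ = u 1 := congrFun hx₀ 1
  have hP0 := le_prob_bit hξ hξ' (fun j => (hp j).2) hu0
  have hP1 := le_prob_bit hξ hξ' (fun j => (hp j).2) hu1
  have hΔ : 0 < (2 * ξ) ^ d := by positivity
  -- For `t = 1`, already ρ ≥ Δ. For `t = -1` the value is ρ(1 - |mean over J|) - Δ/4; here |R| ≤ d
  -- - 1, and the gap 1 - |mean| ≥ 2ξ supplies the missing factor.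
  have hmain : 3 / 4 * (2 * ξ) ^ d ≤ bit t * (bit t * ρ + lam) := by
    rw [mul_add, ← mul_assoc, bit_mul_self, one_mul, hlam, hmean]
    rcases bit_eq_one_or t with h1 | h1
    · have h2 : (2 * ξ) ^ d ≤ (2 * ξ) ^ R.card :=
        pow_le_pow_of_le_one h2ξ.le h2ξ' (by omega)
      have h3 := mul_nonneg hρ0 hαpos.le
      rw [h1]
      linarith
    -- A gate without relevant bits below it has constant target 1.
    · have hJne : J.Nonempty := by
        by_contra hJe
        rw [Finset.not_nonempty_iff_eq_empty] at hJe
        have h := nodeTarget_pattern p I hi j x₀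
        rw [hx₀, ← ht, nodeBit, ← hJ, ← hσ, hJe] at h
        have hσ1 : σ = 1 := by
          rw [hσ, nodeSign, if_neg hi.ne, ← hJ, hJe, signBit, if_pos]
          exact zero_le_one
        rw [h, hσ1] at h1
        have : bit (1 * parity (∅ : Finset (Fin (2 ^ d))) x₀) = 1 := by
          rw [one_mul]
          exact bit_one
        linarith
      have h2 := abs_parityMean_le hξ (fun j => (hp j).2) hJne
      have h3 : (2 * ξ) ^ d ≤ ρ * (2 * ξ) := by
        have h4 : (2 * ξ) ^ (d - 1) ≤ (2 * ξ) ^ R.card :=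
          pow_le_pow_of_le_one h2ξ.le h2ξ' (by have := hJne.card_pos; omega)
        have h5 : (2 * ξ) ^ d = (2 * ξ) ^ (d - 1) * (2 * ξ) := by
          rw [← pow_succ, Nat.sub_add_cancel (by omega)]
        rw [h5]
        exact mul_le_mul_of_nonneg_right (h4.trans hρR) h2ξ.le
      have h6 := mul_le_mul_of_nonneg_left h2 hρ0
      rw [h1]
      linarith
  rw [hE, ← mul_assoc (bit t)]
  calc 3 / 4 * (ξ ^ 2 * (2 * ξ) ^ d) = 3 / 4 * (2 * ξ) ^ d * (ξ * ξ) := by ring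
    _ ≤ _ := mul_le_mul hmain (mul_le_mul hP0 hP1 hξ.le (hξ.le.trans hP0)) (by positivity)
      (le_trans (by positivity) hmain)

/-- The mean label is s times the mean parity, which is nonzero; being nonnegative, it forces the
root sign to be s. -/
theorem nodeBit_zero (hξ : 0 < ξ) (hp₀ : ∀ j, 0 ≤ p j ∧ p j ≤ 1)
    (hp : ∀ j, 2 * ξ ≤ |2 * p j - 1|) (hd : 1 ≤ d) {I : Finset (Fin (2 ^ d))} {s : ℤˣ}
    (hs : 0 ≤ meanLabel (exampleLaw p I s)) (x : Fin (2 ^ d) → ℤˣ) :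
    nodeBit p I 0 x 0 = s * parity I x := by
  have hM : 0 < |parityMean p I| := (pow_pos (by linarith) _).trans_le (pow_le_abs_parityMean hξ hp I)
  rw [nodeBit, nodeSign, if_neg (by omega), leafSet_zero I hd]
  congr 1
  rw [meanLabel_exampleLaw hp₀] at hs
  rw [signBit]
  rcases Int.units_eq_one_or s with rfl | rfl
  · rw [bit_one, one_mul] at hs
    rw [if_pos hs]
  · rw [bit_neg_one] at hs
    rw [if_neg]
    intro h
    rw [show parityMean p I = 0 by linarith, abs_zero] at hM
    exact lt_irrefl _ hM

end

/-! ### The sample -/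

/-- Hoeffding's inequality for the deviation of an empirical mean. -/
theorem measureReal_deviation_le {X : Type*} [MeasurableSpace X] {D : Measure X}
    [IsProbabilityMeasure D] {f : X → ℝ} (hf : Measurable f) {B : ℝ} (hB : 0 < B)
    (hfB : ∀ x, |f x| ≤ B) {m : ℕ} (hm : 0 < m) {t : ℝ} (ht : 0 ≤ t) :
    (Measure.pi fun _ : Fin m => D).real {S | t ≤ |(1 / (m : ℝ)) * ∑ e, f (S e) - ∫ x, f x ∂D|} ≤
      2 * Real.exp (-(m * t ^ 2 / (2 * B ^ 2))) := by
  have hm' : (0 : ℝ) < m := by exact_mod_cast hm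
  have key : ∀ g : X → ℝ, Measurable g → (∀ x, |g x| ≤ B) →
      (Measure.pi fun _ : Fin m => D).real {S | m * t ≤ ∑ e, (g (S e) - ∫ x, g x ∂D)} ≤
      Real.exp (-(m * t ^ 2 / (2 * B ^ 2))) := by
    intro g hg hgB
    have hsub : ProbabilityTheory.HasSubgaussianMGF (fun x => g x - ∫ x, g x ∂D)
        ((‖B - -B‖₊ / 2) ^ 2) D :=
      ProbabilityTheory.hasSubgaussianMGF_of_mem_Icc hg.aemeasurable
        (Filter.Eventually.of_forall fun x => abs_le.1 (hgB x))
    have hind : ProbabilityTheory.iIndepFun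
        (fun (e : Fin m) (S : Fin m → X) => g (S e) - ∫ x, g x ∂D) (Measure.pi fun _ => D) :=
      ProbabilityTheory.iIndepFun_pi (X := fun _ x => g x - ∫ x, g x ∂D)
        fun _ => (hg.sub_const _).aemeasurable
    have hsub' : ∀ e : Fin m, ProbabilityTheory.HasSubgaussianMGF
        (fun S : Fin m → X => g (S e) - ∫ x, g x ∂D) ((‖B - -B‖₊ / 2) ^ 2)
        (Measure.pi fun _ => D) := fun e => by
      refine ProbabilityTheory.HasSubgaussianMGF.of_map (Y := fun S : Fin m → X => S e)
        (X := fun x => g x - ∫ x, g x ∂D) (measurable_pi_apply e).aemeasurable ?_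
      rwa [(measurePreserving_eval (fun _ : Fin m => D) e).map_eq]
    have h := ProbabilityTheory.HasSubgaussianMGF.measure_sum_ge_le_of_iIndepFun hind
      (s := Finset.univ) (fun e _ => hsub' e) (mul_nonneg hm'.le ht)
    refine h.trans (le_of_eq ?_)
    congr 1
    -- Hoeffding's lemma: a range of length 2B gives variance proxy B².
    have hc : (((‖B - -B‖₊ / 2) ^ 2 : NNReal) : ℝ) = B ^ 2 := by
      push_cast
      rw [Real.norm_of_nonneg (by linarith)]
      ring
    rw [Finset.sum_const, Finset.card_univ, Fintype.card_fin, NNReal.coe_nsmul, hc, nsmul_eq_mul]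
    field_simp
  have hsum : ∀ (g : X → ℝ) (S : Fin m → X), ∑ e, (g (S e) - ∫ x, g x ∂D) =
      m * ((1 / (m : ℝ)) * ∑ e, g (S e) - ∫ x, g x ∂D) := fun g S => by
    rw [Finset.sum_sub_distrib, Finset.sum_const, Finset.card_univ, Fintype.card_fin, nsmul_eq_mul]
    field_simp
  have hsubset : {S : Fin m → X | t ≤ |(1 / (m : ℝ)) * ∑ e, f (S e) - ∫ x, f x ∂D|} ⊆
      {S | m * t ≤ ∑ e, (f (S e) - ∫ x, f x ∂D)} ∪
      {S | m * t ≤ ∑ e, ((fun x => -f x) (S e) - ∫ x, (fun x => -f x) x ∂D)} := by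
    intro S hS
    rw [Set.mem_union, Set.mem_ofPred_eq, Set.mem_ofPred_eq, hsum f S,
      hsum (fun x => -f x) S, mul_le_mul_iff_right₀ hm', mul_le_mul_iff_right₀ hm', integral_neg,
      Finset.sum_neg_distrib]
    rcases le_abs.1 (show t ≤ |_| from hS) with h | h
    · exact Or.inl h
    · refine Or.inr (h.trans (le_of_eq ?_))
      ring
  refine (measureReal_mono hsubset).trans ((measureReal_union_le _ _).trans ?_)
  rw [two_mul]
  exact add_le_add (key f hf hfB) (key _ hf.neg fun x => (abs_neg (f x)).trans_le (hfB x))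

/-- The patterns of all gates of a circuit of depth `d`. -/
abbrev GatePattern (d : ℕ) : Type := Σ i : Fin d, Fin (2 ^ (i : ℕ)) × (Fin 2 → ℤˣ)

theorem card_gatePattern (d : ℕ) : (Fintype.card (GatePattern d) : ℝ) = 4 * (2 ^ d - 1) := by
  have h : Fintype.card (GatePattern d) + 4 = 4 * 2 ^ d := by
    rw [Fintype.card_sigma]
    simp only [Fintype.card_prod, Fintype.card_fin, Fintype.card_pi, Fintype.card_units_int,
      Finset.prod_const, Finset.card_univ]
    rw [Fin.sum_univ_eq_sum_range fun i => 2 ^ i * 2 ^ 2, ← Finset.sum_mul]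
    have := Nat.geomSum_eq (m := 2) le_rfl d
    have := Nat.one_le_two_pow (n := d)
    omega
  have h' : (Fintype.card (GatePattern d) : ℝ) + 4 = 4 * 2 ^ d := by exact_mod_cast h
  linarith

section

variable {d m : ℕ} {p : Fin (2 ^ d) → ℝ} {ξ δ : ℝ}

/-- On a random sample, all patterns that occur are correlated with their targets. -/
theorem measureReal_bad_sample_le (hd : 1 ≤ d) (hξ : 0 < ξ) (hξ' : ξ < 1 / 4) (hδ : 0 < δ)
    (hδ' : δ < 1 / 2) (hm : 2 ^ 11 / ((ξ ^ 2) ^ 2 * ((2 * ξ) ^ d) ^ 2) *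
      Real.log (8 * 2 ^ d * d / δ) < m)
    (hp₀ : ∀ j, 0 ≤ p j ∧ p j ≤ 1)
    (hp : ∀ j, 2 * ξ ≤ |2 * p j - 1| ∧ |2 * p j - 1| ≤ 1 - 2 * ξ) {I : Finset (Fin (2 ^ d))}
    (hI : I.card = d) {s : ℤˣ} (hs : 0 ≤ meanLabel (exampleLaw p I s)) {lam : ℝ}
    (hlam : lam = meanLabel (exampleLaw p I s) + (2 * ξ) ^ d / 4) (hlam' : 1 + |lam| ≤ 9 / 4) :
    (Measure.pi fun _ : Fin m => exampleLaw p I s).real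
      {S | ∀ i < d, ∀ (j : Fin (2 ^ i)) u, (∀ x, pattern (nodeBit p I (i + 1) x) j ≠ u) ∨
        ξ ^ 2 * (2 * ξ) ^ d / 2 ≤
          bit (nodeTarget p I i j u) * patternCorr lam S (nodeBit p I (i + 1)) j u}ᶜ ≤
      (δ / (8 * 2 ^ d * d)) ^ 3 := by
  have hD := isProbabilityMeasure_exampleLaw hp₀ I s
  have hΔ : 0 < (2 * ξ) ^ d := by positivity
  have hd' : (1 : ℝ) ≤ d := by exact_mod_cast hd
  have hn : (1 : ℝ) ≤ 2 ^ d := one_le_pow₀ one_le_two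
  -- The allowed deviation is the slack between the population margin 3/4 and the required empirical
  -- margin 1/2.
  set t := ξ ^ 2 * (2 * ξ) ^ d / 4 with ht
  set r := δ / (8 * 2 ^ d * d) with hr
  have ht0 : 0 < t := by positivity
  have hr0 : 0 < r := by positivity
  have hN : (1 : ℝ) ≤ 2 ^ d * d := one_le_mul_of_one_le_of_one_le hn hd'
  have hr1 : r ≤ 1 := by
    rw [hr, div_le_one (by positivity)]
    linarith
  have hlog : Real.log (8 * 2 ^ d * d / δ) = -Real.log r := by
    rw [hr, ← Real.log_inv, inv_div]
  have hL : 0 ≤ -Real.log r := by linarith [Real.log_nonpos hr0.le hr1]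
  have hm0 : 0 < m := by
    have h : (0 : ℝ) < m := lt_of_le_of_lt (by rw [hlog]; positivity) hm
    exact_mod_cast h
  let f : GatePattern d → (Fin (2 ^ d) → ℤˣ) × ℤˣ → ℝ := fun a e =>
    (bit e.2 + lam) * (if pattern (nodeBit p I (a.1 + 1) e.1) a.2.1 = a.2.2 then 1 else 0)
  have hf : ∀ a e, |f a e| ≤ 9 / 4 := fun a e => by
    refine le_trans ?_ hlam'
    simp only [f]
    split_ifs
    · rw [mul_one, ← abs_bit e.2]
      exact abs_add_le _ _
    · rw [mul_zero, abs_zero]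
      positivity
  -- The sample size gives the factor (2^11 / 16) / (81 / 8) > 12; 5 is enough to pay for the union
  -- bound and keep a cube of `r`.
  have hexp : 5 * -Real.log r ≤ m * t ^ 2 / (2 * (9 / 4) ^ 2) := by
    rw [hlog, div_mul_eq_mul_div, div_lt_iff₀ (by positivity)] at hm
    have h : (m : ℝ) * t ^ 2 = m * ((ξ ^ 2) ^ 2 * ((2 * ξ) ^ d) ^ 2) / 16 := by
      rw [ht]
      ring
    rw [h]
    generalize (m : ℝ) * ((ξ ^ 2) ^ 2 * ((2 * ξ) ^ d) ^ 2) = Q at hm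
    generalize -Real.log r = L at hm hL
    rw [show (2 : ℝ) * (9 / 4) ^ 2 = 81 / 8 by norm_num]
    linarith
  have hprob : ∀ a, (Measure.pi fun _ : Fin m => exampleLaw p I s).real
      {S | t ≤ |(1 / (m : ℝ)) * ∑ e, f a (S e) - ∫ x, f a x ∂exampleLaw p I s|} ≤ 2 * r ^ 5 := by
    intro a
    refine (measureReal_deviation_le Measurable.of_discrete (by norm_num) (hf a) hm0 ht0.le).trans ?_
    have h : r ^ 5 = Real.exp (-(5 * -Real.log r)) := by
      rw [show -(5 * -Real.log r) = (5 : ℕ) * Real.log r by push_cast; ring, Real.exp_nat_mul,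
        Real.exp_log hr0]
    rw [h]
    gcongr
  have hsubset : {S : Fin m → (Fin (2 ^ d) → ℤˣ) × ℤˣ | ∀ i < d, ∀ (j : Fin (2 ^ i)) u,
        (∀ x, pattern (nodeBit p I (i + 1) x) j ≠ u) ∨ ξ ^ 2 * (2 * ξ) ^ d / 2 ≤
          bit (nodeTarget p I i j u) * patternCorr lam S (nodeBit p I (i + 1)) j u}ᶜ ⊆
      ⋃ a, {S | t ≤ |(1 / (m : ℝ)) * ∑ e, f a (S e) - ∫ x, f a x ∂exampleLaw p I s|} := by
    intro S hS
    simp only [Set.mem_compl_iff, Set.mem_ofPred_eq, not_forall, not_or] at hS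
    obtain ⟨i, hi, j, u, ⟨x, hx⟩, hlt⟩ := hS
    refine Set.mem_iUnion.2 ⟨⟨⟨i, hi⟩, j, u⟩, ?_⟩
    have h := (le_integral_pattern hξ hξ' hp₀ hp hI hs hlam hi j u).resolve_left
      fun h => hx (h x)
    have h' : bit (nodeTarget p I i j u) * (∫ e, f ⟨⟨i, hi⟩, j, u⟩ e ∂exampleLaw p I s -
        patternCorr lam S (nodeBit p I (i + 1)) j u) ≤
        |patternCorr lam S (nodeBit p I (i + 1)) j u -
          ∫ e, f ⟨⟨i, hi⟩, j, u⟩ e ∂exampleLaw p I s| := by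
      refine (le_abs_self _).trans (le_of_eq ?_)
      rw [abs_mul, abs_bit, one_mul, abs_sub_comm]
    refine le_trans ?_ h'
    rw [mul_sub]
    have h'' : 3 / 4 * (ξ ^ 2 * (2 * ξ) ^ d) ≤ bit (nodeTarget p I i j u) *
        ∫ e, f ⟨⟨i, hi⟩, j, u⟩ e ∂exampleLaw p I s := h
    linarith
  refine (measureReal_mono hsubset).trans ((measureReal_iUnion_fintype_le _).trans ?_)
  refine (Finset.sum_le_sum fun a _ => hprob a).trans ?_
  rw [Finset.sum_const, Finset.card_univ, nsmul_eq_mul, card_gatePattern]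
  have h8 : 8 * 2 ^ d * r ≤ 1 := by
    have h : 8 * 2 ^ d * r = δ / d := by
      rw [hr]
      field_simp
    rw [h]
    exact (div_le_self hδ.le hd').trans (by linarith)
  calc 4 * ((2 : ℝ) ^ d - 1) * (2 * r ^ 5) ≤ 4 * 2 ^ d * (2 * r ^ 5) := by gcongr; linarith
    _ = (8 * 2 ^ d * r) * (r ^ 3 * r) := by ring
    _ ≤ 1 * (r ^ 3 * 1) := by gcongr
    _ = r ^ 3 := by ring

end

/-! ### The initialization -/

/-- Replacing `F a` by `F a \ F b` does not change the union. The overlap saved here pays for the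
failure probability of the sample in `failure_bound`. -/
theorem measureReal_iUnion_le_sub_inter {Ω ι : Type*} [MeasurableSpace Ω] [Fintype ι]
    {μ : Measure Ω} [IsFiniteMeasure μ] {F : ι → Set Ω} {a b : ι} (hab : a ≠ b)
    (hb : MeasurableSet (F b)) :
    μ.real (⋃ i, F i) ≤ ∑ i, μ.real (F i) - μ.real (F a ∩ F b) := by
  classical
  have hsub : ⋃ i, F i ⊆ ⋃ i, Function.update F a (F a \ F b) i := by
    refine Set.iUnion_subset fun i x hx => Set.mem_iUnion.2 ?_
    by_cases hxb : x ∈ F b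
    · exact ⟨b, by rwa [Function.update_of_ne hab.symm]⟩
    · refine ⟨i, ?_⟩
      by_cases hi : i = a
      · subst hi
        rw [Function.update_self]
        exact ⟨hx, hxb⟩
      · rwa [Function.update_of_ne hi]
  refine (measureReal_mono hsub).trans ((measureReal_iUnion_fintype_le _).trans ?_)
  have h := measureReal_inter_add_sdiff (μ := μ) (s := F a) hb
  rw [← Finset.add_sum_erase _ _ (Finset.mem_univ a),
    ← Finset.add_sum_erase _ (fun i => μ.real (F i)) (Finset.mem_univ a), Function.update_self]
  have h' : ∑ i ∈ Finset.univ.erase a, μ.real (Function.update F a (F a \ F b) i) =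
      ∑ i ∈ Finset.univ.erase a, μ.real (F i) :=
    Finset.sum_congr rfl fun i hi => by rw [Function.update_of_ne (Finset.ne_of_mem_erase hi)]
  rw [h']
  linarith

theorem measureReal_pi_forall_mem {X : Type*} [MeasurableSpace X] (κ : Measure X)
    [IsProbabilityMeasure κ] (k : ℕ) (A : Set X) :
    (Measure.pi fun _ : Fin k => κ).real {f | ∀ l, f l ∈ A} = κ.real A ^ k := by
  have h : {f : Fin k → X | ∀ l, f l ∈ A} = Set.univ.pi fun _ => A := by
    ext f
    simp
  rw [h, measureReal_def, Measure.pi_pi, Finset.prod_const, Finset.card_univ, Fintype.card_fin,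
    ENNReal.toReal_pow, measureReal_def]

/-- The weights `(w, v)` of a neuron that respond to the pattern `u` with the sign `τ`. -/
def goodNeurons (u : Fin 2 → ℤˣ) (τ : ℤˣ) : Set ((Fin 2 → ℝ) × ℤˣ) :=
  {w | 0 < dot w (realInput u)} ×ˢ {τ}

theorem measurableSet_goodNeurons (u : Fin 2 → ℤˣ) (τ : ℤˣ) :
    MeasurableSet (goodNeurons u τ) := by
  refine MeasurableSet.prod (measurableSet_lt measurable_const ?_) (measurableSet_singleton τ)
  unfold dot
  fun_prop

theorem measureReal_bitLaw_half (τ : ℤˣ) : (bitLaw (1 / 2)).real {τ} = 1 / 2 := by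
  have := isProbabilityMeasure_bitLaw (p := 1 / 2) (by norm_num) (by norm_num)
  have h := integral_bitLaw (p := 1 / 2) (by norm_num) (by norm_num) (Set.indicator {τ} 1)
  rw [integral_indicator_one (measurableSet_singleton τ)] at h
  rw [h]
  rcases Int.units_eq_one_or τ with rfl | rfl <;> norm_num [Set.indicator]

section

variable {d k : ℕ} {μ : Measure (Fin 2 → ℝ)}

theorem measureReal_goodNeurons (hμ : IsInitLaw k μ) (u : Fin 2 → ℤˣ) (τ : ℤˣ) :
    (μ.prod (bitLaw (1 / 2))).real (goodNeurons u τ) = 1 / 4 := by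
  have := isProbabilityMeasure_bitLaw (p := 1 / 2) (by norm_num) (by norm_num)
  rw [goodNeurons, measureReal_prod_prod, measureReal_bitLaw_half, measureReal_def, hμ.2.2 u]
  norm_num

theorem isProbabilityMeasure_neuronLaw (hμ : IsInitLaw k μ) :
    IsProbabilityMeasure (μ.prod (bitLaw (1 / 2))) := by
  have := hμ.1
  have := isProbabilityMeasure_bitLaw (p := 1 / 2) (by norm_num) (by norm_num)
  infer_instance

theorem isProbabilityMeasure_initLaw (hμ : IsInitLaw k μ) :
    IsProbabilityMeasure (initLaw d k μ) := by
  have := isProbabilityMeasure_neuronLaw hμ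
  rw [initLaw]
  infer_instance

theorem measurePreserving_eval_gate (hμ : IsInitLaw k μ) (i : Fin d) (j : Fin (2 ^ (i : ℕ))) :
    MeasurePreserving (fun ω : Init d k => ω i j) (initLaw d k μ)
      (Measure.pi fun _ : Fin k => μ.prod (bitLaw (1 / 2))) := by
  have := isProbabilityMeasure_neuronLaw hμ
  exact (measurePreserving_eval (fun _ : Fin (2 ^ (i : ℕ)) =>
    Measure.pi fun _ : Fin k => μ.prod (bitLaw (1 / 2))) j).comp
    (measurePreserving_eval (fun i : Fin d => Measure.pi fun _ : Fin (2 ^ (i : ℕ)) =>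
      Measure.pi fun _ : Fin k => μ.prod (bitLaw (1 / 2))) i)

theorem ae_initLaw_bounded (hμ : IsInitLaw k μ) :
    ∀ᵐ ω ∂initLaw d k μ, ∀ i j l q, |(ω i j l).1 q| ≤ 1 / (4 * √2 * k) := by
  have := isProbabilityMeasure_neuronLaw hμ
  have := hμ.1
  have := isProbabilityMeasure_bitLaw (p := 1 / 2) (by norm_num) (by norm_num)
  refine ae_all_iff.2 fun i => ae_all_iff.2 fun j => ae_all_iff.2 fun l => ?_
  exact ((Measure.quasiMeasurePreserving_fst.comp
    (measurePreserving_eval (fun _ : Fin k => μ.prod (bitLaw (1 / 2))) l).quasiMeasurePreserving).comp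
    (measurePreserving_eval_gate hμ i j).quasiMeasurePreserving).ae hμ.2.1

/-- For every gate and every pattern, some neuron responds with the sign of the target. -/
theorem measureReal_bad_init_le (hd : 1 ≤ d) (hμ : IsInitLaw k μ)
    (τ : (i : ℕ) → Fin (2 ^ i) → (Fin 2 → ℤˣ) → ℤˣ) :
    (initLaw d k μ).real {ω | (∀ (i : Fin d) j u, ∃ l, (ω i j l).2 = τ i j u ∧
        0 < dot (ω i j l).1 (realInput u)) ∧ ∀ i j l q, |(ω i j l).1 q| ≤ 1 / (4 * √2 * k)}ᶜ ≤
      4 * (2 ^ d - 1) * (3 / 4) ^ k - (1 / 2) ^ k := by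
  have := isProbabilityMeasure_neuronLaw hμ
  have := isProbabilityMeasure_initLaw (d := d) hμ
  let A : GatePattern d → Set ((Fin 2 → ℝ) × ℤˣ) := fun a => (goodNeurons a.2.2 (τ a.1 a.2.1 a.2.2))ᶜ
  let F : GatePattern d → Set (Init d k) := fun a => {ω | ∀ l, ω a.1 a.2.1 l ∈ A a}
  have hgate : ∀ (i : Fin d) (j : Fin (2 ^ (i : ℕ))) (B : Set ((Fin 2 → ℝ) × ℤˣ)),
      MeasurableSet B → MeasurableSet {f : Fin k → (Fin 2 → ℝ) × ℤˣ | ∀ l, f l ∈ B} := by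
    intro i j B hB
    have h : {f : Fin k → (Fin 2 → ℝ) × ℤˣ | ∀ l, f l ∈ B} = Set.univ.pi fun _ => B := by
      ext f
      simp
    rw [h]
    exact MeasurableSet.univ_pi fun _ => hB
  have hreal : ∀ (i : Fin d) (j : Fin (2 ^ (i : ℕ))) (B : Set ((Fin 2 → ℝ) × ℤˣ)),
      MeasurableSet B → (initLaw d k μ).real {ω | ∀ l, ω i j l ∈ B} =
        (μ.prod (bitLaw (1 / 2))).real B ^ k := by
    intro i j B hB
    rw [← measureReal_pi_forall_mem, ← (measurePreserving_eval_gate hμ i j).measureReal_preimage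
      (hgate i j B hB).nullMeasurableSet]
    rfl
  have hA : ∀ a, MeasurableSet (A a) := fun a => (measurableSet_goodNeurons _ _).compl
  have hF : ∀ a, MeasurableSet (F a) := fun a =>
    (measurePreserving_eval_gate hμ a.1 a.2.1).measurable (hgate a.1 a.2.1 _ (hA a))
  have hFreal : ∀ a, (initLaw d k μ).real (F a) = (3 / 4) ^ k := fun a => by
    rw [hreal _ _ _ (hA a), probReal_compl_eq_one_sub (measurableSet_goodNeurons _ _),
      measureReal_goodNeurons hμ]
    norm_num
  let i₀ : Fin d := ⟨0, hd⟩
  -- Two opposite patterns of one gate: no neuron responds to both, so a neuron misses both with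
  -- probability 1 - 1/4 - 1/4 = 1/2.
  let a₀ : GatePattern d := ⟨i₀, 0, 1⟩
  let a₁ : GatePattern d := ⟨i₀, 0, -1⟩
  have hne : a₀ ≠ a₁ := by
    intro h
    have h' : (1 : Fin 2 → ℤˣ) = -1 := congrArg Prod.snd (eq_of_heq (Sigma.mk.inj h).2)
    exact absurd (congrFun h' 0) (by decide)
  have hinter : (initLaw d k μ).real (F a₀ ∩ F a₁) = (1 / 2) ^ k := by
    have h : F a₀ ∩ F a₁ = {ω | ∀ l, ω i₀ 0 l ∈ (goodNeurons 1 (τ i₀ 0 1) ∪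
        goodNeurons (-1) (τ i₀ 0 (-1)))ᶜ} := by
      ext ω
      simp only [F, A, a₀, a₁, Set.mem_inter_iff, Set.mem_ofPred_eq, Set.compl_union, forall_and]
    have hdisj : Disjoint (goodNeurons 1 (τ i₀ 0 1)) (goodNeurons (-1) (τ i₀ 0 (-1))) := by
      rw [Set.disjoint_left]
      rintro w ⟨h1, -⟩ ⟨h2, -⟩
      have h1' : 0 < dot w.1 (realInput 1) := h1
      have h2' : 0 < dot w.1 (realInput (-1)) := h2
      rw [dot_neg_realInput] at h2'
      linarith
    rw [h, hreal _ _ _ ((measurableSet_goodNeurons _ _).union (measurableSet_goodNeurons _ _)).compl,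
      probReal_compl_eq_one_sub
        ((measurableSet_goodNeurons _ _).union (measurableSet_goodNeurons _ _)),
      measureReal_union hdisj (measurableSet_goodNeurons _ _), measureReal_goodNeurons hμ,
      measureReal_goodNeurons hμ]
    norm_num
  have hsub : {ω : Init d k | (∀ (i : Fin d) j u, ∃ l, (ω i j l).2 = τ i j u ∧
        0 < dot (ω i j l).1 (realInput u)) ∧ ∀ i j l q, |(ω i j l).1 q| ≤ 1 / (4 * √2 * k)}ᶜ ⊆
      (⋃ a, F a) ∪ {ω | ∀ i j l q, |(ω i j l).1 q| ≤ 1 / (4 * √2 * k)}ᶜ := by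
    intro ω hω
    by_contra hcon
    rw [Set.mem_union, not_or, Set.mem_compl_iff, not_not] at hcon
    refine hω ⟨fun i j u => ?_, hcon.2⟩
    by_contra! hl
    refine hcon.1 (Set.mem_iUnion.2 ⟨⟨i, j, u⟩, fun l hmem => ?_⟩)
    exact (hl l hmem.2).not_gt hmem.1
  have hzero : (initLaw d k μ).real {ω | ∀ i j l q, |(ω i j l).1 q| ≤ 1 / (4 * √2 * k)}ᶜ = 0 := by
    rw [measureReal_def, show (initLaw d k μ) _ = 0 from ae_initLaw_bounded hμ,
      ENNReal.toReal_zero]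
  refine (measureReal_mono hsub).trans ((measureReal_union_le _ _).trans ?_)
  rw [hzero, add_zero]
  refine (measureReal_iUnion_le_sub_inter hne (hF a₁)).trans (le_of_eq ?_)
  rw [hinter, Finset.sum_congr rfl fun a _ => hFreal a, Finset.sum_const, Finset.card_univ,
    nsmul_eq_mul, card_gatePattern]

end

/-! ### The success probability -/

/-- The width condition alone gives 2nd(3/4)^k ≤ δ, which may exhaust the budget. Then (3/4)^k is at
least r = δ/(8nd), and the saved overlap (1/2)^k dominates r³ because (3/4)³ ≤ 1/2. -/
theorem failure_bound {d k : ℕ} (hd : 1 ≤ d) {δ : ℝ} (hδ : 0 < δ) (hδ' : δ < 1 / 2)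
    (hk : Real.log (2 * 2 ^ d * d / δ) / Real.log (4 / 3) ≤ k) :
    4 * (2 ^ d - 1) * (3 / 4) ^ k - (1 / 2) ^ k + (δ / (8 * 2 ^ d * d)) ^ 3 ≤ δ := by
  have hd' : (1 : ℝ) ≤ d := by exact_mod_cast hd
  have hn : (1 : ℝ) ≤ 2 ^ d := one_le_pow₀ one_le_two
  have hN : (1 : ℝ) ≤ 2 ^ d * d := one_le_mul_of_one_le_of_one_le hn hd'
  have hlog : 0 < Real.log (4 / 3) := Real.log_pos (by norm_num)
  have hq : 2 * (2 ^ d * d) * (3 / 4 : ℝ) ^ k ≤ δ := by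
    rw [div_le_iff₀ hlog, ← Real.log_pow, Real.log_le_log_iff (by positivity) (by positivity),
      div_le_iff₀ hδ] at hk
    have h : (4 / 3 : ℝ) ^ k * (3 / 4) ^ k = 1 := by
      rw [← mul_pow]
      norm_num
    have hpos : (0 : ℝ) < (3 / 4) ^ k := by positivity
    calc 2 * (2 ^ d * d) * (3 / 4 : ℝ) ^ k = 2 * 2 ^ d * d * (3 / 4 : ℝ) ^ k := by ring
      _ ≤ (4 / 3) ^ k * δ * (3 / 4) ^ k := by gcongr
      _ = (4 / 3) ^ k * (3 / 4) ^ k * δ := by ring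
      _ = δ := by rw [h, one_mul]
  -- Equality holds for `d = 1`, so counting patterns leaves no slack there.
  have hcard : 4 * ((2 : ℝ) ^ d - 1) ≤ 2 * (2 ^ d * d) := by
    rcases Nat.lt_or_ge 1 d with h | h
    · have : (2 : ℝ) ≤ d := by exact_mod_cast h
      nlinarith
    · have : d = 1 := by omega
      rw [this]
      norm_num
  have hcard' := mul_le_mul_of_nonneg_right hcard (by positivity : (0 : ℝ) ≤ (3 / 4) ^ k)
  set r := δ / (8 * 2 ^ d * d) with hr
  have hrN : 8 * (2 ^ d * d) * r = δ := by
    rw [hr]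
    field_simp
  have hr0 : 0 < r := by positivity
  have hrδ : 8 * r ≤ δ := by nlinarith
  have hr3 : r ^ 3 ≤ r := pow_le_of_le_one hr0.le (by linarith) (by norm_num)
  have hhalf : (0 : ℝ) < (1 / 2) ^ k := by positivity
  by_cases hcase : 2 * (2 ^ d * d) * (3 / 4 : ℝ) ^ k ≤ δ / 2
  · linarith
  · have hrq : r ≤ (3 / 4) ^ k := by
      by_contra! hlt
      have := mul_le_mul_of_nonneg_left hlt.le (by positivity : (0 : ℝ) ≤ 2 * (2 ^ d * d))
      linarith
    have h1 : r ^ 3 ≤ (1 / 2) ^ k := by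
      calc r ^ 3 ≤ ((3 / 4 : ℝ) ^ k) ^ 3 := by gcongr
        _ = ((3 / 4 : ℝ) ^ 3) ^ k := by rw [← pow_mul, mul_comm, pow_mul]
        _ ≤ (1 / 2) ^ k := by gcongr; norm_num
    linarith

theorem ofReal_le_prod_of_compl {α β : Type*} [MeasurableSpace α] [MeasurableSpace β]
    {μ : Measure α} {ν : Measure β} [IsProbabilityMeasure μ] [IsProbabilityMeasure ν] {s : Set α}
    {t : Set β} {a b δ : ℝ} (hs : μ.real sᶜ ≤ a) (ht : ν.real tᶜ ≤ b) (hab : a + b ≤ δ)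
    {A : Set (α × β)} (hA : s ×ˢ t ⊆ A) : ENNReal.ofReal (1 - δ) ≤ (μ.prod ν) A := by
  refine le_trans ?_ (measure_mono hA)
  refine ENNReal.ofReal_le_of_le_toReal ?_
  rw [← measureReal_def, measureReal_prod_prod]
  -- Subadditivity suffices, so none of the sets has to be measurable.
  have h1 : 1 ≤ μ.real s + μ.real sᶜ := by
    rw [← probReal_univ (μ := μ), ← Set.union_compl_self s]
    exact measureReal_union_le _ _
  have h2 : 1 ≤ ν.real t + ν.real tᶜ := by
    rw [← probReal_univ (μ := ν), ← Set.union_compl_self t]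
    exact measureReal_union_le _ _
  have h3 : μ.real s ≤ 1 := measureReal_le_one
  have h4 : ν.real t ≤ 1 := measureReal_le_one
  nlinarith

section

variable {d k m T : ℕ} {p : Fin (2 ^ d) → ℝ} {ξ δ η : ℝ}

theorem abs_dot_le {w : Fin 2 → ℝ} {b : ℝ} (hw : ∀ q, |w q| ≤ b) (u : Fin 2 → ℤˣ) :
    |dot w (realInput u)| ≤ 2 * b := by
  rw [dot, Fin.sum_univ_two, two_mul]
  refine (abs_add_le _ _).trans (add_le_add ?_ ?_) <;>
  · rw [abs_mul, realInput, abs_bit, mul_one]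
    exact hw _

/-- With high probability, layerwise gradient descent returns the target function. -/
theorem layerwiseGD_success (hd : 1 ≤ d) (hξ : 0 < ξ) (hξ' : ξ < 1 / 4) (hδ : 0 < δ)
    (hδ' : δ < 1 / 2) (hadm : Admissible ξ δ d k m T η) {μ : Measure (Fin 2 → ℝ)}
    (hμ : IsInitLaw k μ)
    (hpξ : ∀ j, p j ∈ Set.Ioo ξ (1 / 2 - ξ) ∪ Set.Ioo (1 / 2 + ξ) (1 - ξ))
    {I : Finset (Fin (2 ^ d))} (hI : I.card = d) {s : ℤˣ}
    (hs : 0 ≤ meanLabel (exampleLaw p I s)) {lam : ℝ}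
    (hlam : lam = meanLabel (exampleLaw p I s) + (2 * ξ) ^ d / 4) :
    ENNReal.ofReal (1 - δ) ≤
      ((Measure.pi fun _ : Fin m => exampleLaw p I s).prod (initLaw d k μ))
      {z | ∀ x : Fin (2 ^ d) → ℤˣ, layerwiseGD lam η T z.1 z.2 (realInput x) =
        bit (s * (parityCircuit I).eval x)} := by
  have hp₀ : ∀ j, 0 ≤ p j ∧ p j ≤ 1 := fun j => by
    rcases hpξ j with h | h <;> constructor <;> linarith [h.1, h.2]
  have hp : ∀ j, 2 * ξ ≤ |2 * p j - 1| ∧ |2 * p j - 1| ≤ 1 - 2 * ξ := fun j => by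
    rcases hpξ j with h | h
    · rw [abs_of_neg (by linarith [h.2])]
      constructor <;> linarith [h.1, h.2]
    · rw [abs_of_pos (by linarith [h.1])]
      constructor <;> linarith [h.1, h.2]
  have := isProbabilityMeasure_exampleLaw hp₀ I s
  have := isProbabilityMeasure_initLaw (d := d) hμ
  have hΔ : 0 < (2 * ξ) ^ d := by positivity
  have hΔ1 : (2 * ξ) ^ d ≤ 1 := pow_le_one₀ (by linarith) (by linarith)
  have hlam' : 1 + |lam| ≤ 9 / 4 := by
    have hle : meanLabel (exampleLaw p I s) ≤ 1 := by
      rw [meanLabel_exampleLaw hp₀]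
      refine (le_abs_self _).trans ?_
      rw [abs_mul, abs_bit, one_mul, parityMean, Finset.abs_prod]
      exact Finset.prod_le_one (fun _ _ => abs_nonneg _) fun j _ => (hp j).2.trans (by linarith)
    rw [hlam, abs_of_nonneg (by linarith)]
    linarith
  have hk : (0 : ℝ) < k := by
    refine lt_of_lt_of_le (div_pos (Real.log_pos ?_) (Real.log_pos (by norm_num))) hadm.width
    have hn : (1 : ℝ) ≤ 2 ^ d := one_le_pow₀ one_le_two
    have hd' : (1 : ℝ) ≤ d := by exact_mod_cast hd
    rw [lt_div_iff₀ hδ]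
    have := one_le_mul_of_one_le_of_one_le hn hd'
    linarith
  have h2 : 0 < √2 := by positivity
  have h2' : √2 * √2 = 2 := Real.mul_self_sqrt zero_le_two
  have h2l : 1 ≤ √2 := Real.one_le_sqrt.2 one_le_two
  have h2u : √2 ≤ 3 / 2 := Real.sqrt_le_left (by norm_num) |>.2 (by norm_num)
  refine ofReal_le_prod_of_compl
    (measureReal_bad_sample_le hd hξ hξ' hδ hδ' hadm.sample hp₀ hp hI hs hlam hlam')
    (measureReal_bad_init_le hd hμ (nodeTarget p I))
    (by linarith [failure_bound hd hδ hδ' hadm.width]) ?_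
  rintro ⟨S, ω⟩ ⟨hS, hω⟩ x
  have hη := hadm.rate_pos
  -- β is twice the coordinate bound of the initial weights, since a pattern has two coordinates;
  -- 9/4 bounds 1 + |lam| because lam ≤ 1 + 1/4.
  have hres := trainFrom_eq (β := 1 / (2 * √2 * k)) (B := 9 / 4) (c := ξ ^ 2 * (2 * ξ) ^ d / 2)
    (T := T) hη (by positivity) ?_ hS hlam' (by norm_num) ?_ ?_ hω.1 ?_ d le_rfl id
    (fun x => by rw [nodeBit_depth, id]) x
  · refine hres.trans ?_
    rw [nodeBit_zero hξ hp₀ (fun j => (hp j).1) hd hs, parityCircuit_eval I hd]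
  · have h : (k : ℝ) * (1 / (2 * √2 * k)) = 1 / (2 * √2) := by field_simp
    rw [h]
    exact one_div_le_one_div_of_le two_pos (by linarith)
  · have h := mul_le_mul_of_nonneg_left hadm.rate_le (by norm_num : (0 : ℝ) ≤ 9 / 2)
    have h' : 2 * (1 / (2 * √2 * k)) = 16 * (1 / (16 * √2 * k)) := by field_simp
    have h'' : 0 < 1 / (16 * √2 * k) := by positivity
    linarith
  · intro i j l u
    refine (abs_dot_le (hω.2 i j l) u).trans (le_of_eq ?_)
    field_simp
    norm_num
  · have h := hadm.iters
    rw [div_lt_iff₀ (by positivity)] at h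
    have hn : (0 : ℝ) < 2 ^ d := by positivity
    have h' : (T : ℝ) * (4 * η / 2 ^ d * (ξ ^ 2 * (2 * ξ) ^ d / 2)) =
        T * (√2 * η * ξ ^ 2 * (2 * ξ) ^ d) * √2 / 2 ^ d := by
      have : (T : ℝ) * (√2 * η * ξ ^ 2 * (2 * ξ) ^ d) * √2 / 2 ^ d =
          T * (√2 * √2) * η * ξ ^ 2 * (2 * ξ) ^ d / 2 ^ d := by ring
      rw [this, h2']
      ring
    rw [h', lt_div_iff₀ hn]
    -- The iteration bound makes the total drift exceed 6√2, more than the required 4.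
    have h3 := mul_lt_mul_of_pos_right h h2
    nlinarith

end

end LayerwiseGD

end

theorem mainTheorem6 (ξ : ℝ) (hξ : 0 < ξ) (hξ' : ξ < 1 / 4) :
    -- the circuit of the parity computes the parity
    (∀ (d : ℕ), 1 ≤ d → ∀ (I : Finset (Fin (2 ^ d))) (x : Fin (2 ^ d) → ℤˣ),
      (LayerwiseGD.parityCircuit I).eval x = LayerwiseGD.parity I x) ∧
    -- with probability at least `1 - δ` the algorithm returns the target function; `n = 2 ^ d`
    (∀ (d : ℕ), 1 ≤ d → ∀ (δ : ℝ), 0 < δ → δ < 1 / 2 →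
      ∀ (k m T : ℕ) (η : ℝ), LayerwiseGD.Admissible ξ δ d k m T η →
      ∀ (μ : MeasureTheory.Measure (Fin 2 → ℝ)), LayerwiseGD.IsInitLaw k μ →
      ∀ (p : Fin (2 ^ d) → ℝ),
        (∀ j, p j ∈ Set.Ioo ξ (1 / 2 - ξ) ∪ Set.Ioo (1 / 2 + ξ) (1 - ξ)) →
      ∀ (I : Finset (Fin (2 ^ d))), I.card = d →
      ∀ (s : ℤˣ), 0 ≤ LayerwiseGD.meanLabel (LayerwiseGD.exampleLaw p I s) →
      ∀ (lam : ℝ),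
        lam = LayerwiseGD.meanLabel (LayerwiseGD.exampleLaw p I s) + (2 * ξ) ^ d / 4 →
      ENNReal.ofReal (1 - δ) ≤
        ((MeasureTheory.Measure.pi fun _ : Fin m => LayerwiseGD.exampleLaw p I s).prod
          (LayerwiseGD.initLaw d k μ))
        {z | ∀ x : Fin (2 ^ d) → ℤˣ,
          LayerwiseGD.layerwiseGD lam η T z.1 z.2 (LayerwiseGD.realInput x) =
            LayerwiseGD.bit (s * (LayerwiseGD.parityCircuit I).eval x)}) ∧
    -- sample size and number of steps are polynomial in `n = 2 ^ d`
    (∃ (C : ℝ) (a : ℕ), ∀ (d : ℕ), 1 ≤ d → ∀ (δ : ℝ), 0 < δ → δ < 1 / 2 →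
      ∃ (k m T : ℕ) (η : ℝ), LayerwiseGD.Admissible ξ δ d k m T η ∧
        (m : ℝ) ≤ C * ((2 : ℝ) ^ d * Real.log (1 / δ)) ^ a ∧
        ∀ (lam : ℝ) (S : Fin m → (Fin (2 ^ d) → ℤˣ) × ℤˣ) (ω : LayerwiseGD.Init d k),
          LayerwiseGD.NetWeights.eval d (LayerwiseGD.Timed.layerwiseGD lam η T S ω).val =
            LayerwiseGD.layerwiseGD lam η T S ω ∧
          ((LayerwiseGD.Timed.layerwiseGD lam η T S ω).steps : ℝ) ≤
            C * ((2 : ℝ) ^ d * Real.log (1 / δ)) ^ a) := by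
  refine ⟨fun d hd I x => LayerwiseGD.parityCircuit_eval I hd x, ?_, ?_⟩
  · intro d hd δ hδ hδ' k m T η hadm μ hμ p hp I hI s hs lam hlam
    exact LayerwiseGD.layerwiseGD_success hd hξ hξ' hδ hδ' hadm hμ hp hI hs hlam
  · obtain ⟨C, a, h⟩ := LayerwiseGD.exists_admissible_polyBounded hξ
    refine ⟨C, a, fun d hd δ hδ hδ' => ?_⟩
    obtain ⟨k, m, T, η, hadm, hm, hsteps⟩ := h d hd δ hδ hδ'
    refine ⟨k, m, T, η, hadm, hm, fun lam S ω =>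
      ⟨LayerwiseGD.Timed.eval_layerwiseGD lam η T S ω, le_trans ?_ hsteps⟩⟩
    exact_mod_cast LayerwiseGD.Timed.steps_layerwiseGD_le lam η T S ω
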